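/- **Setting.** A *resistance form* on a set $Y$ is a pair $(\mathcal E,\mathcal F)$ of a linear space $\mathcal F$ of real functions on $Y$ containing the constants and a nonnegative definite symmetric bilinear form $\mathcal E$ on $\mathcal F$ (with $\mathcal E(u):=\mathcal E(u,u)$) such that $\mathcal E(u)=0$ iff $u$ is constant; $\mathcal F$ modulo constants is a Hilbert space under $\mathcal E$; every function on a finite subset of $Y$ extends to an element of $\mathcal F$; $R(x,y):=\sup\{|u(x)-u(y)|^2/\mathcal E(u):\mathcal E(u)>0\}<\infty$ for all $x,y$; and $\bar u=\max(0,\min(1,u))\in\mathcal F$ with $\mathcal E(\bar u)\le\mathcal E(u)$ for $u\in\mathcal F$. Suppose $R$ induces a compact topology on $Y$. For finite $V\subset Y$ let $c(V;p,q)$ be the weights with $\min\{\mathcal E(w):w|_V=u|_V\}=\frac12\sum_{p,q\in V}c(V;p,q)(u(p)-u(q))^2$. Write $(g\cdot v)(x,y)=\frac12(g(x)+g(y))v(x,y)$ and $d_uf(x,y)=f(x)-f(y)$. The Hilbert space $\mathcal H$ of generalized $L^2$-vector fields is the completion, after factoring out elements of zero seminorm, of the $C(Y)$-module generated by $\{d_uf:f\in\mathcal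 F\}$ under $\langle v,w\rangle_{\mathcal H}=\lim_V\frac12\sum_{p,q\in V}c(V;p,q)v(p,q)w(p,q)$ (limit over finite $V\subset Y$ directed by inclusion); $\partial f\in\mathcal H$ is the class of $d_uf$, and $g\cdot v$ extends continuously to $g\in C(Y)$, $v\in\mathcal H$. The energy measure $\nu_f$ of $f\in\mathcal F$ is the finite Borel measure with $\int g\,d\nu_f=\mathcal E(fg,f)-\frac12\mathcal E(f^2,g)$ for $g\in\mathcal F$. Let $X$ be a compact metric space with a *finitely ramified cell structure*: a countable set $\mathcal A$, pairwise distinct compact connected (nonempty) cells $X_\alpha\subset X$ and finite sets $V_\alpha\subset X_\alpha$ ($\alpha\in\mathcal A$), and pairwise disjoint finite sets $\mathcal A_n\subset\mathcal A$ ($n\ge 0$), such that $\mathcal A_0=\{0\}$ and $X_0=X$; each $X_\alpha$, $\alpha\in\mathcal A_n$, is a finite union of cells $X_\beta$ with $\beta\in\mathcal A_{n+1}$; $V_\alpha\subset\bigcup_jV_{\alpha_j}$ whenever $X_\alpha=\bigcup_{j}X_{\alpha_j}$ (finite union); $X_\alpha\cap X_{\alpha'}=V_\alpha\cap V_{\alpha'}$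 for distinct $\alpha,\alpha'\in\mathcal A_n$; and $\bigcap_nX_{\alpha_n}$ is a single point for every strictly decreasing sequence of cells. Put $V_n=\bigcup_{\alpha\in\mathcal A_n}V_\alpha$. Let $(\mathcal E,\mathcal F)$ be a resistance form on $X$ whose resistance metric $R$ induces the topology of $X$; assume that $\bigcup_nV_n$ is dense in $X$ and $\max_{\alpha\in\mathcal A_n}\operatorname{diam}_R(X_\alpha)\to0$. Let $H_m(X)$ be the set of $m$-harmonic functions, i.e. of those $u\in\mathcal F$ which minimize the energy among all functions in $\mathcal F$ with the same values on $V_m$; for $u\in\mathcal F$ let $H_mu\in H_m(X)$ agree with $u$ on $V_m$. Let $X^{(0)}\subset X^{(1)}\subset\dots\subset X$ be compact, $X^{(m)}=\bigcup_{\alpha\in\mathcal A_m}X^{(m)}_\alpha$ with $V_\alpha\subset X^{(m)}_\alpha\subset X_\alpha$, and let $(\mathcal E^{(m)},\mathcal F^{(m)})$ be a resistance form on $X^{(m)}$ whose resistance metric $R^{(m)}$ induces the subspace topology. Objects associated with it carry the superscript $(m)$. Let $\mu,\mu^{(m)}$ be finite Borel measures on $X$, $X^{(m)}$, positive on nonempty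 open sets, and $\mathcal E_1^{(m)}(u)=\mathcal E^{(m)}(u)+\|u\|^2_{L^2(X^{(m)},\mu^{(m)})}$. Assume: 1. Restriction $u\mapsto u|_{X^{(m)}}$ maps $H_m(X)$ injectively into $\mathcal F^{(m)}$, with $\mathcal E^{(m)}(u|_{X^{(m)}})=\mathcal E(u)$; and $\nu^{(m)}_{H_m(u)|_{X^{(m)}}}\to\nu_u$ weakly on $X$ for $u\in\mathcal F$. Write $H_m(X^{(m)})$ for the image, $\operatorname{ext}_m:H_m(X^{(m)})\to H_m(X)$ for the inverse map, and let $H_m^{(m)}$ be a linear projection of $\mathcal F^{(m)}$ onto $H_m(X^{(m)})$ with $\mathcal E^{(m)}(v-H^{(m)}_mv,w)=0$ for $v\in\mathcal F^{(m)}$, $w\in H_m(X^{(m)})$. 2. If $u_m\in\mathcal F^{(m)}$ and $\sup_m\mathcal E^{(m)}(u_m)<\infty$ then $\|u_m-H_m^{(m)}u_m\|_{\sup}\to0$; for $u,w\in H_n(X)$, $\mathcal E^{(m)}\big((uw)|_{X^{(m)}}-H_m^{(m)}((uw)|_{X^{(m)}})\big)\to0$ as $m\to\infty$. 3. There is a non-increasing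 $V:\mathbb N\to(0,\infty)$ with $\mu(X_\alpha)\ge V(m)$ and $\mu^{(m)}(X^{(m)}_\alpha)\ge V(m)$ for all $m$, $\alpha\in\mathcal A_m$. 4. There are bounded linear $\Phi_m:L^2(X,\mu)\to L^2(X^{(m)},\mu^{(m)})$ with $\sup_m\|\Phi_m\|<\infty$, $\|\Phi_mu\|\to\|u\|$ for $u\in L^2(X,\mu)$, $\Phi_m^*\Phi_mu\to u$ in $L^2(X,\mu)$ for $u\in H_n(X)$, and $\|\Phi_mu_m-u_m|_{X^{(m)}}\|_{L^2}\to0$ whenever $u_m\in\mathcal F$, $\sup_m\mathcal E(u_m)<\infty$. 5. If $u_m\in\mathcal F^{(m)}$ and $\sup_m\mathcal E^{(m)}_1(u_m)<\infty$ then $\sup_m\|\operatorname{ext}_mH^{(m)}_mu_m\|_{L^2(X,\mu)}<\infty$. **Coefficients.** Let $0<\lambda<\Lambda$, $a\in C(X)$ with $\lambda<a<\Lambda$, and $b^{(m)},\hat b^{(m)}\in\mathcal H^{(m)}$ with $B:=\sup_m\|b^{(m)}\|^2<\infty$, $\hat B:=\sup_m\|\hat b^{(m)}\|^2<\infty$.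 Let $M>0$ be so large that $\frac\lambda2-\frac1{\sqrt M}>0$. Let $n_0$ be such that $4MB\operatorname{diam}_{R^{(m)}}(X_\alpha\cap X^{(m)})\le1$ for all $m\ge n_0$, $\alpha\in\mathcal A_{n_0}$, and put $\gamma_M=\frac2{V(n_0)}\sup_{m\ge n_0}\|b^{(m)}\|^2$; define $\hat n_0$ and $\hat\gamma_M$ in the same way from $\hat b^{(m)}$ and $\hat B$. Let $c\in C(X)$ satisfy $$\operatorname*{ess\,inf}_{x\in X}(-c(x))-\frac{\gamma_M+\hat\gamma_M}{\lambda-2/\sqrt M}>0 .$$ For $f,g\in\mathcal F^{(m)}$ let $$\mathcal Q^{(m)}(f,g)=\langle a|_{X^{(m)}}\cdot\partial^{(m)} f,\partial^{(m)} g\rangle_{\mathcal H^{(m)}}-\langle g\cdot b^{(m)},\partial^{(m)} f\rangle_{\mathcal H^{(m)}}-\langle f\cdot\hat b^{(m)},\partial^{(m)} g\rangle_{\mathcal H^{(m)}}-\langle c|_{X^{(m)}}f,g\rangle_{L^2(X^{(m)},\mu^{(m)})},$$ and let $\mathcal L^{(m)}$ be its generator: $u\in\mathcal D(\mathcal L^{(m)})$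 and $\mathcal L^{(m)}u=w$ iff $u\in\mathcal F^{(m)}$, $w\in L^2(X^{(m)},\mu^{(m)})$ and $\mathcal Q^{(m)}(u,g)=-\langle w,g\rangle_{L^2}$ for all $g\in\mathcal F^{(m)}$. **Corollary 5.11.** (i) Let $f\in L^2(X,\mu)$ and let $u_m\in\mathcal F^{(m)}$ be, for all sufficiently large $m$, the weak solution of $\mathcal L^{(m)}u_m=\Phi_mf$, i.e. $\mathcal Q^{(m)}(u_m,g)=-\langle\Phi_mf,g\rangle_{L^2(X^{(m)},\mu^{(m)})}$ for all $g\in\mathcal F^{(m)}$. Then every subsequence $(u_{m_k})_k$ has a further subsequence $(u_{m_{k_j}})_j$ such that $(\operatorname{ext}_{m_{k_j}}H^{(m_{k_j})}_{m_{k_j}}u_{m_{k_j}})_j$ converges uniformly on $X$ to some $\tilde u\in C(X)$. (ii) Let $\mathring u\in L^2(X,\mu)$ and let $u_m\in C([0,\infty),L^2(X^{(m)},\mu^{(m)}))\cap C^1((0,\infty),L^2(X^{(m)},\mu^{(m)}))$ be, for all sufficiently large $m$, the solution of $u_m'(t)=\mathcal L^{(m)}u_m(t)$, $t>0$ (with $u_m(t)\in\mathcal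 D(\mathcal L^{(m)})$), $u_m(0)=\Phi_m\mathring u$. Then for every $t>0$ every subsequence $(u_{m_k}(t))_k$ has a further subsequence $(u_{m_{k_j}}(t))_j$ such that $(\operatorname{ext}_{m_{k_j}}H^{(m_{k_j})}_{m_{k_j}}u_{m_{k_j}}(t))_j$ converges uniformly on $X$ to some $\tilde u_t\in C(X)$. -/

import Mathlib

open Filter Topology MeasureTheory
open scoped ENNReal

noncomputable section

/-- A resistance form on a set `X`: a linear space `dom` of real functions on `X` together with a
symmetric bilinear form on it, subject to the five standard axioms. -/
structure ResistanceForm (X : Type*) where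
  /-- the space of functions of finite energy -/
  dom : Submodule ℝ (X → ℝ)
  /-- the energy form -/
  form : LinearMap.BilinForm ℝ dom
  symm : ∀ u v, form u v = form v u
  nonneg : ∀ u, 0 ≤ form u u
  const_mem : ∀ r : ℝ, (fun _ => r) ∈ dom
  eq_zero_iff : ∀ u : dom, form u u = 0 ↔ ∃ r : ℝ, ∀ x, u.1 x = r
  /-- completeness of the space modulo constants -/
  complete : ∀ u : ℕ → dom,
    (∀ ε > 0, ∃ N, ∀ m ≥ N, ∀ n ≥ N, form (u m - u n) (u m - u n) < ε) →
    ∃ v : dom, Tendsto (fun n => form (u n - v) (u n - v)) atTop (𝓝 0)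
  exists_extension : ∀ (V : Finset X) (v : X → ℝ), ∃ u : dom, ∀ x ∈ V, u.1 x = v x
  bddAbove_resistance : ∀ x y : X,
    BddAbove {r : ℝ | ∃ u : dom, 0 < form u u ∧ r = (u.1 x - u.1 y) ^ 2 / form u u}
  unit_contraction : ∀ u : dom, ∃ v : dom,
    (∀ x, v.1 x = max 0 (min 1 (u.1 x))) ∧ form v v ≤ form u u

namespace ResistanceForm

variable {X : Type*} (E : ResistanceForm X)

/-- The resistance metric. -/
def resistance (x y : X) : ℝ :=
  sSup {r : ℝ | ∃ u : E.dom, 0 < E.form u u ∧ r = (u.1 x - u.1 y) ^ 2 / E.form u u}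

/-- The trace of the form on a finite set `V`, as a quadratic form: the least energy of a function
with the given values on `V`. -/
def trace (V : Finset X) (v : X → ℝ) : ℝ :=
  sInf {r : ℝ | ∃ u : E.dom, (∀ x ∈ V, u.1 x = v x) ∧ r = E.form u u}

/-- The indicator function of a point. -/
def ind (p : X) : X → ℝ := Set.indicator {p} 1

open Classical in
/-- The edge weights `c(V; p, q)` of the trace on `V`, i.e. the (off-diagonal) coefficients in
`E_V(u) = 1/2 ∑_{p, q ∈ V} c(V; p, q) (u p - u q) ^ 2`; by polarization
`c(V; p, q) = - E_V(1_p, 1_q)` for `p ≠ q`. -/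
def weight (V : Finset X) (p q : X) : ℝ :=
  if p = q then 0
  else (E.trace V (ind p) + E.trace V (ind q) - E.trace V (ind p + ind q)) / 2

/-- The approximation on `V` of the scalar product of two functions on `X × X`. -/
def approxInner (V : Finset X) (v w : X → X → ℝ) : ℝ :=
  1 / 2 * ∑ p ∈ V, ∑ q ∈ V, E.weight V p q * v p q * w p q

/-- The universal derivation. -/
def du (f : X → ℝ) : X → X → ℝ := fun x y => f x - f y

/-- The action of functions on two-point functions, through the average. -/
def act (g : X → ℝ) (v : X → X → ℝ) : X → X → ℝ := fun x y => (g x + g y) / 2 * v x y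

/-! ### Basic facts -/

lemma isSymm : LinearMap.IsSymm E.form := ⟨fun u v => E.symm u v⟩

lemma form_add (u v : E.dom) :
    E.form (u + v) (u + v) = E.form u u + 2 * E.form u v + E.form v v := by
  simp only [map_add, LinearMap.add_apply]; rw [E.symm v u]; ring

lemma form_sub (u v : E.dom) :
    E.form (u - v) (u - v) = E.form u u - 2 * E.form u v + E.form v v := by
  simp only [map_sub, LinearMap.sub_apply]; rw [E.symm v u]; ring

lemma form_add_smul (u v : E.dom) (t : ℝ) :
    E.form (u + t • v) (u + t • v) = E.form u u + 2 * t * E.form u v + t ^ 2 * E.form v v := by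
  rw [form_add]; simp only [map_smul, LinearMap.smul_apply, smul_eq_mul]; ring

lemma cs (u v : E.dom) : E.form u v ^ 2 ≤ E.form u u * E.form v v :=
  LinearMap.BilinForm.apply_sq_le_of_symm E.form E.nonneg E.isSymm u v

lemma form_sub_le (u v w : E.dom) :
    E.form (u - w) (u - w) ≤ 2 * E.form (u - v) (u - v) + 2 * E.form (v - w) (v - w) := by
  have h1 := E.form_add (u - v) (v - w)
  have h2 := E.form_sub (u - v) (v - w)
  have h3 := E.nonneg ((u - v) - (v - w))
  rw [sub_add_sub_cancel] at h1
  linarith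

/-- A constant function, as an element of the domain. -/
def const (r : ℝ) : E.dom := ⟨fun _ => r, E.const_mem r⟩

@[simp] lemma const_apply (r : ℝ) (x : X) : (E.const r).1 x = r := rfl

lemma form_const_right (u : E.dom) (r : ℝ) : E.form u (E.const r) = 0 := by
  have h : E.form (E.const r) (E.const r) = 0 := (E.eq_zero_iff _).2 ⟨r, fun _ => rfl⟩
  have := E.cs u (E.const r)
  rw [h, mul_zero] at this
  exact pow_eq_zero_iff (two_ne_zero) |>.1 (le_antisymm this (sq_nonneg _))

lemma form_const_left (u : E.dom) (r : ℝ) : E.form (E.const r) u = 0 := by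
  rw [E.symm, form_const_right]

lemma sq_sub_le (u : E.dom) (x y : X) :
    (u.1 x - u.1 y) ^ 2 ≤ E.resistance x y * E.form u u := by
  rcases (E.nonneg u).eq_or_lt with h | h
  · obtain ⟨r, hr⟩ := (E.eq_zero_iff u).1 h.symm
    rw [hr, hr, ← h]; simp
  · rw [← div_le_iff₀ h]
    exact le_csSup (E.bddAbove_resistance x y) ⟨u, h, rfl⟩

lemma resistance_nonneg (x y : X) : 0 ≤ E.resistance x y := by
  apply Real.sSup_nonneg
  rintro r ⟨u, hu, rfl⟩
  positivity

/-- A sequence whose energy distances are controlled by `a m + a n` with `a → 0` converges in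
energy. -/
lemma exists_limit (u : ℕ → E.dom) (a : ℕ → ℝ) (ha : Tendsto a atTop (𝓝 0))
    (h : ∀ m n, E.form (u m - u n) (u m - u n) ≤ a m + a n) :
    ∃ v : E.dom, Tendsto (fun n => E.form (u n - v) (u n - v)) atTop (𝓝 0) := by
  apply E.complete
  intro ε hε
  obtain ⟨N, hN⟩ := eventually_atTop.1 (ha.eventually (gt_mem_nhds (half_pos hε)))
  exact ⟨N, fun m hm n hn => by linarith [h m n, hN m hm, hN n hn]⟩

/-- Convergence in energy implies convergence of differences of values. -/
lemma tendsto_sub_of_energy {u : ℕ → E.dom} {v : E.dom}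
    (h : Tendsto (fun n => E.form (u n - v) (u n - v)) atTop (𝓝 0)) (x y : X) :
    Tendsto (fun n => (u n).1 x - (u n).1 y) atTop (𝓝 (v.1 x - v.1 y)) := by
  have h1 : Tendsto (fun n => E.resistance x y * E.form (u n - v) (u n - v)) atTop (𝓝 0) := by
    simpa using h.const_mul (E.resistance x y)
  have h2 : Tendsto (fun n => ((u n - v).1 x - (u n - v).1 y) ^ 2) atTop (𝓝 0) :=
    squeeze_zero (fun n => sq_nonneg _) (fun n => E.sq_sub_le _ x y) h1
  have h3 : Tendsto (fun n => (u n - v).1 x - (u n - v).1 y) atTop (𝓝 0) := by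
    have := h2.sqrt
    simp only [Real.sqrt_sq_eq_abs, Real.sqrt_zero] at this
    exact (tendsto_zero_iff_abs_tendsto_zero _).2 this
  have h4 := h3.add_const (v.1 x - v.1 y)
  rw [zero_add] at h4
  refine h4.congr fun n => ?_
  simp only [Submodule.coe_sub, Pi.sub_apply]; ring

lemma tendsto_form_left {u : ℕ → E.dom} {v : E.dom}
    (h : Tendsto (fun n => E.form (u n - v) (u n - v)) atTop (𝓝 0)) (w : E.dom) :
    Tendsto (fun n => E.form (u n) w) atTop (𝓝 (E.form v w)) := by
  have h1 : Tendsto (fun n => E.form (u n - v) (u n - v) * E.form w w) atTop (𝓝 0) := by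
    simpa using h.mul_const (E.form w w)
  have h2 : Tendsto (fun n => (E.form (u n - v) w) ^ 2) atTop (𝓝 0) :=
    squeeze_zero (fun n => sq_nonneg _) (fun n => E.cs _ _) h1
  have h3 : Tendsto (fun n => E.form (u n - v) w) atTop (𝓝 0) := by
    have := h2.sqrt
    simp only [Real.sqrt_sq_eq_abs, Real.sqrt_zero] at this
    exact (tendsto_zero_iff_abs_tendsto_zero _).2 this
  have h4 := h3.add_const (E.form v w)
  rw [zero_add] at h4
  refine h4.congr fun n => ?_
  simp

lemma tendsto_form_self {u : ℕ → E.dom} {v : E.dom}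
    (h : Tendsto (fun n => E.form (u n - v) (u n - v)) atTop (𝓝 0)) :
    Tendsto (fun n => E.form (u n) (u n)) atTop (𝓝 (E.form v v)) := by
  have h1 := (h.sub (tendsto_const_nhds (x := E.form v v))).add
    ((E.tendsto_form_left h v).const_mul 2)
  have : (0 - E.form v v + 2 * E.form v v) = E.form v v := by ring
  rw [this] at h1
  refine h1.congr fun n => ?_
  rw [form_sub]; ring

/-- Existence of the energy minimizer with prescribed values on a finite set, in its orthogonality
form. -/
lemma exists_harmonic (V : Finset X) (v : X → ℝ) :
    ∃ h : E.dom, (∀ x ∈ V, h.1 x = v x) ∧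
      ∀ w : E.dom, (∀ x ∈ V, w.1 x = 0) → E.form h w = 0 := by
  rcases V.eq_empty_or_nonempty with rfl | ⟨x0, hx0⟩
  · exact ⟨0, by simp, by simp⟩
  set S := {r : ℝ | ∃ u : E.dom, (∀ x ∈ V, u.1 x = v x) ∧ r = E.form u u} with hS
  have hSne : S.Nonempty := by
    obtain ⟨u, hu⟩ := E.exists_extension V v
    exact ⟨_, u, hu, rfl⟩
  have hSb : BddBelow S := ⟨0, by rintro r ⟨u, -, rfl⟩; exact E.nonneg u⟩
  have hmin : ∀ u : E.dom, (∀ x ∈ V, u.1 x = v x) → sInf S ≤ E.form u u :=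
    fun u hu => csInf_le hSb ⟨u, hu, rfl⟩
  have hex : ∀ n : ℕ, ∃ u : E.dom, (∀ x ∈ V, u.1 x = v x) ∧
      E.form u u < sInf S + 1 / ((n : ℝ) + 1) := by
    intro n
    obtain ⟨r, ⟨u, hu, rfl⟩, hr⟩ := Real.lt_sInf_add_pos hSne
      (show (0 : ℝ) < 1 / ((n : ℝ) + 1) by positivity)
    exact ⟨u, hu, hr⟩
  choose u hu hlt using hex
  have ha0 : Tendsto (fun n : ℕ => 1 / ((n : ℝ) + 1)) atTop (𝓝 0) :=
    tendsto_one_div_add_atTop_nhds_zero_nat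
  have hcau : ∀ m n, E.form (u m - u n) (u m - u n)
      ≤ 2 * (1 / ((m : ℝ) + 1)) + 2 * (1 / ((n : ℝ) + 1)) := by
    intro m n
    have h1 := hmin ((1 / 2 : ℝ) • (u m + u n)) (fun x hx => by
      simp only [Submodule.coe_smul, Submodule.coe_add, Pi.smul_apply, Pi.add_apply, hu m x hx,
        hu n x hx, smul_eq_mul]; ring)
    simp only [map_smul, LinearMap.smul_apply, smul_eq_mul, form_add] at h1
    rw [form_sub]
    linarith [hlt m, hlt n]
  obtain ⟨z, hz⟩ := E.exists_limit u (fun n => 2 * (1 / ((n : ℝ) + 1)))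
    (by simpa using ha0.const_mul 2) hcau
  refine ⟨z + E.const (v x0 - z.1 x0), fun x hx => ?_, fun w hw => ?_⟩
  · have h1 := E.tendsto_sub_of_energy hz x x0
    have h2 : Tendsto (fun n => (u n).1 x - (u n).1 x0) atTop (𝓝 (v x - v x0)) := by
      simp only [hu _ x hx, hu _ x0 hx0]; exact tendsto_const_nhds
    have h3 := tendsto_nhds_unique h1 h2
    simp only [Submodule.coe_add, Pi.add_apply, const_apply]
    linarith
  · have key : ∀ t : ℝ, 0 ≤ 2 * t * E.form z w + t ^ 2 * E.form w w := by
      intro t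
      have h1 : Tendsto (fun n => 2 * t * E.form (u n) w + t ^ 2 * E.form w w
          + 1 / ((n : ℝ) + 1)) atTop (𝓝 (2 * t * E.form z w + t ^ 2 * E.form w w + 0)) :=
        (((E.tendsto_form_left hz w).const_mul (2 * t)).add_const _).add ha0
      rw [add_zero] at h1
      refine ge_of_tendsto' h1 fun n => ?_
      have h2 := hmin (u n + t • w) (fun x hx => by simp [hu n x hx, hw x hx])
      rw [form_add_smul] at h2
      linarith [hlt n]
    have hw0 := E.nonneg w
    have hz0 : E.form z w = 0 := by
      have k := key (-(E.form z w / (E.form w w + 1)))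
      have hp : 0 < E.form w w + 1 := by linarith
      by_contra hne
      have hsq : 0 < E.form z w ^ 2 := by positivity
      have : 2 * -(E.form z w / (E.form w w + 1)) * E.form z w
          + (-(E.form z w / (E.form w w + 1))) ^ 2 * E.form w w
          = - (E.form z w ^ 2 * (E.form w w + 2)) / (E.form w w + 1) ^ 2 := by
        field_simp; ring
      rw [this] at k
      have : 0 < (E.form z w ^ 2 * (E.form w w + 2)) / (E.form w w + 1) ^ 2 := by positivity
      rw [neg_div] at k
      linarith
    rw [map_add, LinearMap.add_apply, hz0, form_const_left, add_zero]

/-- A harmonic extension from `V`. -/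
def hext (V : Finset X) (v : X → ℝ) : E.dom := (E.exists_harmonic V v).choose

lemma hext_apply {V : Finset X} (v : X → ℝ) {x : X} (hx : x ∈ V) : (E.hext V v).1 x = v x :=
  (E.exists_harmonic V v).choose_spec.1 x hx

lemma hext_orth {V : Finset X} (v : X → ℝ) {w : E.dom} (hw : ∀ x ∈ V, w.1 x = 0) :
    E.form (E.hext V v) w = 0 :=
  (E.exists_harmonic V v).choose_spec.2 w hw

lemma form_hext_eq {V : Finset X} (v : X → ℝ) {w w' : E.dom} (h : ∀ x ∈ V, w.1 x = w'.1 x) :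
    E.form (E.hext V v) w = E.form (E.hext V v) w' := by
  rw [← sub_eq_zero, ← map_sub]
  exact E.hext_orth v fun x hx => by simp [h x hx]

lemma form_hext_le {V : Finset X} {v : X → ℝ} {u : E.dom} (h : ∀ x ∈ V, u.1 x = v x) :
    E.form (E.hext V v) (E.hext V v) ≤ E.form u u := by
  have h1 := E.form_hext_eq v (w := u) (w' := E.hext V v)
    (fun x hx => by rw [h x hx, E.hext_apply v hx])
  have h2 := E.nonneg (E.hext V v - u)
  rw [form_sub, h1] at h2
  linarith

lemma trace_eq (V : Finset X) (v : X → ℝ) :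
    E.trace V v = E.form (E.hext V v) (E.hext V v) := by
  refine IsLeast.csInf_eq ⟨⟨_, fun x hx => E.hext_apply v hx, rfl⟩, ?_⟩
  rintro r ⟨u, hu, rfl⟩
  exact E.form_hext_le hu

/-- The trace form, as a bilinear quantity. -/
def tr (V : Finset X) (v w : X → ℝ) : ℝ := E.form (E.hext V v) (E.hext V w)

lemma tr_eq_of_eq {V : Finset X} {v w : X → ℝ} {u : E.dom} (h : ∀ x ∈ V, u.1 x = w x) :
    E.tr V v w = E.form (E.hext V v) u :=
  E.form_hext_eq v fun x hx => by rw [h x hx, E.hext_apply w hx]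

lemma tr_comm (V : Finset X) (v w : X → ℝ) : E.tr V v w = E.tr V w v := E.symm _ _

lemma tr_add_right (V : Finset X) (v w w' : X → ℝ) :
    E.tr V v (w + w') = E.tr V v w + E.tr V v w' := by
  rw [E.tr_eq_of_eq (u := E.hext V w + E.hext V w')
    (fun x hx => by simp [E.hext_apply _ hx]), map_add]; rfl

lemma tr_smul_right (V : Finset X) (v w : X → ℝ) (r : ℝ) :
    E.tr V v (r • w) = r * E.tr V v w := by
  rw [E.tr_eq_of_eq (u := r • E.hext V w)
    (fun x hx => by simp [E.hext_apply _ hx]), map_smul]; rfl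

lemma tr_congr_right {V : Finset X} (v : X → ℝ) {w w' : X → ℝ} (h : ∀ x ∈ V, w x = w' x) :
    E.tr V v w = E.tr V v w' :=
  E.tr_eq_of_eq fun x hx => by rw [E.hext_apply _ hx, h x hx]

lemma tr_const_right (V : Finset X) (v : X → ℝ) (r : ℝ) : E.tr V v (fun _ => r) = 0 :=
  (E.tr_eq_of_eq (u := E.const r) fun _ _ => rfl).trans (E.form_const_right _ _)

lemma weight_of_ne (V : Finset X) {p q : X} (h : p ≠ q) :
    E.weight V p q = - E.tr V (ind p) (ind q) := by
  rw [weight, if_neg h, trace_eq, trace_eq, trace_eq]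
  change (E.tr V (ind p) (ind p) + E.tr V (ind q) (ind q)
    - E.tr V (ind p + ind q) (ind p + ind q)) / 2 = _
  rw [tr_add_right, E.tr_comm V (ind p + ind q) (ind p), E.tr_comm V (ind p + ind q) (ind q),
    tr_add_right, tr_add_right, E.tr_comm V (ind q) (ind p)]
  ring

lemma tr_sum_right (V W : Finset X) (v : X → ℝ) (a : X → ℝ) (w : X → X → ℝ) :
    E.tr V v (∑ p ∈ W, a p • w p) = ∑ p ∈ W, a p * E.tr V v (w p) := by
  classical
  induction W using Finset.induction_on with
  | empty => rw [Finset.sum_empty, Finset.sum_empty]; exact E.tr_const_right V v 0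
  | insert p W hp ih => rw [Finset.sum_insert hp, Finset.sum_insert hp, tr_add_right,
      tr_smul_right, ih]

lemma tr_expand_right (V : Finset X) (v w : X → ℝ) :
    E.tr V v w = ∑ q ∈ V, w q * E.tr V v (ind q) := by
  classical
  rw [← tr_sum_right]
  refine E.tr_congr_right v fun x hx => ?_
  rw [Finset.sum_apply, Finset.sum_eq_single x]
  · simp [ind]
  · intro b _ hb; simp [ind, hb.symm]
  · exact fun h => absurd hx h

lemma tr_expand (V : Finset X) (v w : X → ℝ) :
    E.tr V v w = ∑ p ∈ V, ∑ q ∈ V, v p * w q * E.tr V (ind p) (ind q) := by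
  rw [tr_comm, tr_expand_right]
  refine Finset.sum_congr rfl fun p _ => ?_
  rw [tr_comm, tr_expand_right, Finset.mul_sum]
  exact Finset.sum_congr rfl fun q _ => by ring

lemma approxInner_du (V : Finset X) (f g : X → ℝ) :
    E.approxInner V (du f) (du g) = E.tr V f g := by
  have hrow : ∀ p, ∑ q ∈ V, E.tr V (ind p) (ind q) = 0 := by
    intro p
    have := E.tr_expand_right V (ind p) (fun _ => 1)
    rw [tr_const_right] at this
    simpa using this.symm
  have hcol : ∀ q, ∑ p ∈ V, E.tr V (ind p) (ind q) = 0 := by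
    intro q; rw [← hrow q]; exact Finset.sum_congr rfl fun p _ => E.tr_comm _ _ _
  have h1 : ∀ p q, E.weight V p q * du f p q * du g p q
      = -(f p * g p * E.tr V (ind p) (ind q)) + f p * g q * E.tr V (ind p) (ind q)
        + g p * f q * E.tr V (ind p) (ind q) - f q * g q * E.tr V (ind p) (ind q) := by
    intro p q
    by_cases h : p = q
    · subst h; simp only [du]; ring
    · rw [E.weight_of_ne V h]; simp only [du]; ring
  have h2 : ∑ p ∈ V, ∑ q ∈ V, f p * g p * E.tr V (ind p) (ind q) = 0 :=
    Finset.sum_eq_zero fun p _ => by rw [← Finset.mul_sum, hrow, mul_zero]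
  have h3 : ∑ p ∈ V, ∑ q ∈ V, f q * g q * E.tr V (ind p) (ind q) = 0 := by
    rw [Finset.sum_comm]
    exact Finset.sum_eq_zero fun p _ => by rw [← Finset.mul_sum, hcol, mul_zero]
  rw [approxInner]
  simp only [h1, Finset.sum_add_distrib, Finset.sum_sub_distrib, Finset.sum_neg_distrib, h2, h3]
  rw [← tr_expand, ← tr_expand, E.tr_comm V g f]; ring

lemma weight_nonneg (V : Finset X) {p q : X} (hp : p ∈ V) (hq : q ∈ V) : 0 ≤ E.weight V p q := by
  by_cases h : p = q
  · simp [weight, h]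
  rw [E.weight_of_ne V h, neg_nonneg]
  have key : ∀ t : ℝ, 0 < t → 2 * E.tr V (ind p) (ind q) ≤ t * E.tr V (ind q) (ind q) := by
    intro t ht
    obtain ⟨v, hv, hle⟩ := E.unit_contraction (E.hext V (ind p) + (-t) • E.hext V (ind q))
    have h1 : ∀ x ∈ V, v.1 x = ind p x := by
      intro x hx
      rw [hv]
      simp only [Submodule.coe_add, Submodule.coe_smul, Pi.add_apply, Pi.smul_apply, smul_eq_mul,
        E.hext_apply _ hx]
      by_cases hxp : x = p
      · subst hxp; simp [ind, h]
      · by_cases hxq : x = q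
        · subst hxq; simp [ind, hxp, ht.le]
        · simp [ind, hxp, hxq]
    have h2 := (E.form_hext_le h1).trans hle
    rw [form_add_smul] at h2
    change E.tr V (ind p) (ind p) ≤ E.tr V (ind p) (ind p)
      + 2 * -t * E.tr V (ind p) (ind q) + (-t) ^ 2 * E.tr V (ind q) (ind q) at h2
    have h3 : t * (2 * E.tr V (ind p) (ind q)) ≤ t * (t * E.tr V (ind q) (ind q)) := by
      nlinarith
    exact le_of_mul_le_mul_left h3 ht
  have hlim : Tendsto (fun t : ℝ => t * E.tr V (ind q) (ind q)) (𝓝[>] 0) (𝓝 0) := by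
    have : Tendsto (fun t : ℝ => t * E.tr V (ind q) (ind q)) (𝓝 0) (𝓝 (0 * _)) :=
      tendsto_id.mul_const _
    rw [zero_mul] at this
    exact this.mono_left nhdsWithin_le_nhds
  have := ge_of_tendsto hlim (eventually_nhdsWithin_of_forall fun t ht => key t ht)
  linarith

lemma tr_mono {V W : Finset X} (h : V ⊆ W) (v : X → ℝ) : E.tr V v v ≤ E.tr W v v :=
  E.form_hext_le fun _ hx => E.hext_apply v (h hx)

lemma form_hext_sub {V W : Finset X} (h : V ⊆ W) (v : X → ℝ) :
    E.form (E.hext W v - E.hext V v) (E.hext W v - E.hext V v) = E.tr W v v - E.tr V v v := by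
  have h1 : E.form (E.hext V v) (E.hext W v) = E.tr V v v :=
    E.form_hext_eq v fun x hx => by rw [E.hext_apply v hx, E.hext_apply v (h hx)]
  rw [form_sub, E.symm (E.hext W v) (E.hext V v), h1]
  simp only [tr]; ring

/-- A function whose traces have bounded energy belongs to the domain, and its energy is the
limit of the energies of its traces. -/
lemma exists_mem_of_bounded (v : X → ℝ) (C : ℝ) (hC : ∀ V, E.tr V v v ≤ C) :
    ∃ u : E.dom, u.1 = v ∧ Tendsto (fun V => E.tr V v v) atTop (𝓝 (E.form u u)) := by
  classical
  have hbdd : BddAbove (Set.range fun V => E.tr V v v) := ⟨C, by rintro _ ⟨V, rfl⟩; exact hC V⟩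
  have hlim : Tendsto (fun V => E.tr V v v) atTop (𝓝 (⨆ V, E.tr V v v)) :=
    tendsto_atTop_ciSup (fun V W h => E.tr_mono h v) hbdd
  set s := ⨆ V, E.tr V v v with hs
  have hex : ∀ n : ℕ, ∃ V, s - 1 / ((n : ℝ) + 1) < E.tr V v v := fun n =>
    exists_lt_of_lt_ciSup (by have : (0 : ℝ) < 1 / ((n : ℝ) + 1) := by positivity
                              linarith)
  choose W hW using hex
  have hle : ∀ V, E.tr V v v ≤ s := fun V => le_ciSup hbdd V
  have ha0 : Tendsto (fun n : ℕ => 1 / ((n : ℝ) + 1)) atTop (𝓝 0) :=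
    tendsto_one_div_add_atTop_nhds_zero_nat
  have hun : ∀ n (U : Finset X), E.form (E.hext (W n ∪ U) v - E.hext (W n) v)
      (E.hext (W n ∪ U) v - E.hext (W n) v) ≤ 1 / ((n : ℝ) + 1) := by
    intro n U
    rw [E.form_hext_sub Finset.subset_union_left]
    linarith [hle (W n ∪ U), hW n]
  have hneg : ∀ a b : E.dom, E.form (a - b) (a - b) = E.form (b - a) (b - a) := by
    intro a b; rw [form_sub, form_sub, E.symm a b]; ring
  obtain ⟨z, hz⟩ := E.exists_limit (fun n => E.hext (W n) v) (fun n => 2 * (1 / ((n : ℝ) + 1)))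
    (by simpa using ha0.const_mul 2) (fun m n => by
      have h1 := E.form_sub_le (E.hext (W m) v) (E.hext (W m ∪ W n) v) (E.hext (W n) v)
      have h2 := hun m (W n)
      have h3 := hun n (W m)
      rw [Finset.union_comm (W n)] at h3
      rw [hneg (E.hext (W m) v) (E.hext (W m ∪ W n) v)] at h1
      linarith)
  have hzs : E.form z z = s := by
    refine tendsto_nhds_unique (E.tendsto_form_self hz) ?_
    have h1 : Tendsto (fun n : ℕ => s - 1 / ((n : ℝ) + 1)) atTop (𝓝 (s - 0)) :=
      tendsto_const_nhds.sub ha0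
    rw [sub_zero] at h1
    exact tendsto_of_tendsto_of_tendsto_of_le_of_le h1 tendsto_const_nhds
      (fun n => (hW n).le) (fun n => hle _)
  have hval : ∀ x y, z.1 x - z.1 y = v x - v y := by
    intro x y
    have h1 : Tendsto (fun n => E.form (E.hext (W n ∪ {x, y}) v - z)
        (E.hext (W n ∪ {x, y}) v - z)) atTop (𝓝 0) := by
      have h2 : Tendsto (fun n : ℕ => 2 * (1 / ((n : ℝ) + 1)) +
          2 * E.form (E.hext (W n) v - z) (E.hext (W n) v - z)) atTop (𝓝 0) := by
        simpa using (ha0.const_mul 2).add (hz.const_mul 2)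
      refine squeeze_zero (fun n => E.nonneg _) (fun n => ?_) h2
      have h3 := E.form_sub_le (E.hext (W n ∪ {x, y}) v) (E.hext (W n) v) z
      linarith [hun n {x, y}]
    refine tendsto_nhds_unique (E.tendsto_sub_of_energy h1 x y) ?_
    refine tendsto_const_nhds.congr fun n => ?_
    rw [E.hext_apply v (by simp), E.hext_apply v (by simp)]
  rcases isEmpty_or_nonempty X with hX | ⟨⟨x0⟩⟩
  · exact ⟨z, funext fun x => hX.elim x, by rw [hzs]; exact hlim⟩
  · refine ⟨z + E.const (v x0 - z.1 x0), ?_, ?_⟩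
    · funext x
      simp only [Submodule.coe_add, Pi.add_apply, const_apply]
      linarith [hval x x0]
    · rw [form_add, form_const_right, form_const_right, hzs]
      simpa using hlim

lemma tr_le (V : Finset X) (f : E.dom) : E.tr V f.1 f.1 ≤ E.form f f :=
  E.form_hext_le fun _ _ => rfl

lemma tendsto_tr_self (f : E.dom) :
    Tendsto (fun V => E.tr V f.1 f.1) atTop (𝓝 (E.form f f)) := by
  obtain ⟨u, hu, h⟩ := E.exists_mem_of_bounded f.1 _ (fun V => E.tr_le V f)
  rwa [Subtype.ext hu] at h

lemma tendsto_tr (f g : E.dom) :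
    Tendsto (fun V => E.tr V f.1 g.1) atTop (𝓝 (E.form f g)) := by
  have h := ((E.tendsto_tr_self (f + g)).sub (E.tendsto_tr_self f)).sub (E.tendsto_tr_self g)
  have h2 := h.const_mul (1 / 2)
  rw [form_add] at h2
  have e : 1 / 2 * (E.form f f + 2 * E.form f g + E.form g g - E.form f f - E.form g g)
      = E.form f g := by ring
  rw [e] at h2
  refine h2.congr fun V => ?_
  simp only [Submodule.coe_add, tr_add_right]
  rw [E.tr_comm V (f.1 + g.1), E.tr_comm V (f.1 + g.1), tr_add_right, tr_add_right,
    E.tr_comm V g.1 f.1]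
  ring

/-! ### Properties of `approxInner` -/

lemma approxInner_comm (V : Finset X) (v w : X → X → ℝ) :
    E.approxInner V v w = E.approxInner V w v := by
  simp only [approxInner]
  congr 1
  exact Finset.sum_congr rfl fun p _ => Finset.sum_congr rfl fun q _ => by ring

lemma approxInner_add_left (V : Finset X) (v v' w : X → X → ℝ) :
    E.approxInner V (v + v') w = E.approxInner V v w + E.approxInner V v' w := by
  simp only [approxInner, ← mul_add, ← Finset.sum_add_distrib]
  congr 1
  exact Finset.sum_congr rfl fun p _ => Finset.sum_congr rfl fun q _ => by
    simp only [Pi.add_apply]; ring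

lemma approxInner_smul_left (V : Finset X) (r : ℝ) (v w : X → X → ℝ) :
    E.approxInner V (r • v) w = r * E.approxInner V v w := by
  simp only [approxInner, Finset.mul_sum]
  exact Finset.sum_congr rfl fun p _ => Finset.sum_congr rfl fun q _ => by
    simp only [Pi.smul_apply, smul_eq_mul]; ring

lemma approxInner_self_nonneg (V : Finset X) (v : X → X → ℝ) : 0 ≤ E.approxInner V v v := by
  refine mul_nonneg (by norm_num) (Finset.sum_nonneg fun p hp => Finset.sum_nonneg fun q hq => ?_)
  rw [mul_assoc]
  exact mul_nonneg (E.weight_nonneg V hp hq) (mul_self_nonneg _)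

lemma approxInner_mono {V : Finset X} {v w : X → X → ℝ} (h : ∀ p q, v p q ^ 2 ≤ w p q ^ 2) :
    E.approxInner V v v ≤ E.approxInner V w w := by
  refine mul_le_mul_of_nonneg_left (Finset.sum_le_sum fun p hp => Finset.sum_le_sum fun q hq => ?_)
    (by norm_num)
  rw [mul_assoc, mul_assoc, ← sq, ← sq]
  exact mul_le_mul_of_nonneg_left (h p q) (E.weight_nonneg V hp hq)

lemma approxInner_abs_le (V : Finset X) (K : ℝ) (w : X → X → ℝ) (hw : ∀ p q, |w p q| ≤ K)
    (f g : E.dom) :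
    |E.approxInner V (w * du f.1) (du g.1)| ≤ K * (E.form f f + E.form g g) := by
  have hK : ∀ p : X, 0 ≤ K := fun p => (abs_nonneg _).trans (hw p p)
  have h1 : |E.approxInner V (w * du f.1) (du g.1)| ≤
      1 / 2 * ∑ p ∈ V, ∑ q ∈ V, (K * (E.weight V p q * du f.1 p q * du f.1 p q)
        + K * (E.weight V p q * du g.1 p q * du g.1 p q)) := by
    rw [approxInner, abs_mul, abs_of_pos (by norm_num : (0 : ℝ) < 1 / 2)]
    refine mul_le_mul_of_nonneg_left ?_ (by norm_num)
    refine (Finset.abs_sum_le_sum_abs _ _).trans (Finset.sum_le_sum fun p hp => ?_)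
    refine (Finset.abs_sum_le_sum_abs _ _).trans (Finset.sum_le_sum fun q hq => ?_)
    have hc := E.weight_nonneg V hp hq
    have e : E.weight V p q * (w * du f.1) p q * du g.1 p q
      = w p q * (E.weight V p q * (du f.1 p q * du g.1 p q)) := by
        simp only [Pi.mul_apply]; ring
    rw [e, abs_mul, abs_mul, abs_of_nonneg hc]
    have h2 : |du f.1 p q * du g.1 p q| ≤ du f.1 p q ^ 2 + du g.1 p q ^ 2 := by
      rw [abs_le]; constructor <;> nlinarith [sq_nonneg (du f.1 p q + du g.1 p q),
        sq_nonneg (du f.1 p q - du g.1 p q), sq_nonneg (du f.1 p q), sq_nonneg (du g.1 p q)]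
    calc |w p q| * (E.weight V p q * |du f.1 p q * du g.1 p q|)
        ≤ K * (E.weight V p q * (du f.1 p q ^ 2 + du g.1 p q ^ 2)) :=
          mul_le_mul (hw p q) (mul_le_mul_of_nonneg_left h2 hc)
            (mul_nonneg hc (abs_nonneg _)) (hK p)
      _ = _ := by ring
  refine h1.trans ?_
  simp only [Finset.sum_add_distrib, ← Finset.mul_sum]
  have hf := E.tr_le V f
  have hg := E.tr_le V g
  rw [← approxInner_du, approxInner] at hf hg
  rcases V.eq_empty_or_nonempty with rfl | ⟨p, -⟩
  · rcases isEmpty_or_nonempty X with hX | ⟨⟨x⟩⟩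
    · have hf0 := (E.eq_zero_iff f).2 ⟨0, fun x => hX.elim x⟩
      have hg0 := (E.eq_zero_iff g).2 ⟨0, fun x => hX.elim x⟩
      simp [hf0, hg0]
    · simpa using mul_nonneg (hK x) (add_nonneg (E.nonneg f) (E.nonneg g))
  · nlinarith [hK p]

/-- Products of bounded functions of the domain. -/
lemma mul_mem (f g : E.dom) {K L : ℝ} (hf : ∀ x, |f.1 x| ≤ K) (hg : ∀ x, |g.1 x| ≤ L) :
    f.1 * g.1 ∈ E.dom := by
  obtain ⟨u, hu, -⟩ := E.exists_mem_of_bounded (f.1 * g.1)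
    (2 * K ^ 2 * E.form g g + 2 * L ^ 2 * E.form f f) (fun V => by
      rw [← approxInner_du, approxInner]
      have h1 := E.tr_le V f
      have h2 := E.tr_le V g
      rw [← approxInner_du, approxInner] at h1 h2
      have h3 : ∑ p ∈ V, ∑ q ∈ V, E.weight V p q * du (f.1 * g.1) p q * du (f.1 * g.1) p q
          ≤ ∑ p ∈ V, ∑ q ∈ V, (2 * K ^ 2 * (E.weight V p q * du g.1 p q * du g.1 p q)
            + 2 * L ^ 2 * (E.weight V p q * du f.1 p q * du f.1 p q)) := by
        refine Finset.sum_le_sum fun p hp => Finset.sum_le_sum fun q hq => ?_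
        have hc := E.weight_nonneg V hp hq
        have e : du (f.1 * g.1) p q = f.1 p * du g.1 p q + g.1 q * du f.1 p q := by
          simp only [du, Pi.mul_apply]; ring
        have a1 : (f.1 p * du g.1 p q) ^ 2 ≤ K ^ 2 * du g.1 p q ^ 2 := by
          rw [mul_pow]; exact mul_le_mul_of_nonneg_right (sq_le_sq' (by linarith [abs_le.1 (hf p)])
            (abs_le.1 (hf p)).2) (sq_nonneg _)
        have a2 : (g.1 q * du f.1 p q) ^ 2 ≤ L ^ 2 * du f.1 p q ^ 2 := by
          rw [mul_pow]; exact mul_le_mul_of_nonneg_right (sq_le_sq' (by linarith [abs_le.1 (hg q)])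
            (abs_le.1 (hg q)).2) (sq_nonneg _)
        rw [e]
        have a3 : (f.1 p * du g.1 p q + g.1 q * du f.1 p q) ^ 2
            ≤ 2 * (K ^ 2 * du g.1 p q ^ 2) + 2 * (L ^ 2 * du f.1 p q ^ 2) := by
          nlinarith [sq_nonneg (f.1 p * du g.1 p q - g.1 q * du f.1 p q)]
        nlinarith [mul_le_mul_of_nonneg_left a3 hc]
      simp only [Finset.sum_add_distrib, ← Finset.mul_sum] at h3
      nlinarith [mul_le_mul_of_nonneg_left h1 (by positivity : 0 ≤ 2 * L ^ 2),
        mul_le_mul_of_nonneg_left h2 (by positivity : 0 ≤ 2 * K ^ 2)])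
  exact hu ▸ u.2

end ResistanceForm

/-- A resistance form on a compact topological space, whose resistance metric induces the
topology. -/
structure CompactResistanceForm (Y : Type*) [TopologicalSpace Y] [CompactSpace Y] extends
    ResistanceForm Y where
  nhds_basis : ∀ x : Y, (𝓝 x).HasBasis (fun ε : ℝ => 0 < ε)
    (fun ε => {y | toResistanceForm.resistance x y < ε})

namespace CompactResistanceForm

open ResistanceForm

variable {Y : Type*} [TopologicalSpace Y] [CompactSpace Y] (E : CompactResistanceForm Y)

lemma continuous_dom (f : E.dom) : Continuous f.1 := by
  rw [continuous_iff_continuousAt]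
  intro x
  rw [ContinuousAt, (E.nhds_basis x).tendsto_iff Metric.nhds_basis_ball]
  intro ε hε
  have hp : 0 < E.form f f + 1 := by linarith [E.nonneg f]
  refine ⟨ε ^ 2 / (E.form f f + 1), by positivity, fun y hy => ?_⟩
  have h1 := E.sq_sub_le f x y
  have hy' : E.resistance x y < ε ^ 2 / (E.form f f + 1) := hy
  rw [lt_div_iff₀ hp] at hy'
  have h2 : (f.1 x - f.1 y) ^ 2 < ε ^ 2 := by
    nlinarith [E.resistance_nonneg x y, E.nonneg f]
  rw [Metric.mem_ball, Real.dist_eq, abs_sub_comm]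
  exact abs_lt_of_sq_lt_sq h2 hε.le

/-- A function of finite energy, as a continuous function. -/
def toC : E.dom →ₗ[ℝ] C(Y, ℝ) where
  toFun f := ⟨f.1, E.continuous_dom f⟩
  map_add' _ _ := rfl
  map_smul' _ _ := rfl

@[simp] lemma toC_apply (f : E.dom) (x : Y) : E.toC f x = f.1 x := rfl

lemma abs_le_norm (f : E.dom) (x : Y) : |f.1 x| ≤ ‖E.toC f‖ := (E.toC f).norm_coe_le_norm x

/-- The pointwise product of two functions of finite energy. -/
def mul (f g : E.dom) : E.dom :=
  ⟨f.1 * g.1, E.mul_mem f g (E.abs_le_norm f) (E.abs_le_norm g)⟩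

/-- Functions of finite energy are uniformly dense (the form is regular). -/
lemma exists_approx (g : C(Y, ℝ)) {ε : ℝ} (hε : 0 < ε) :
    ∃ f : E.dom, ∀ x, |g x - f.1 x| < ε := by
  let A : Subalgebra ℝ C(Y, ℝ) :=
    { carrier := {h | ⇑h ∈ E.dom}
      mul_mem' := fun {a b} ha hb => (E.mul ⟨_, ha⟩ ⟨_, hb⟩).2
      add_mem' := fun {a b} ha hb => E.dom.add_mem ha hb
      algebraMap_mem' := fun r => E.const_mem r }
  have hsep : A.SeparatesPoints := by
    classical
    intro x y hxy
    obtain ⟨u, hu⟩ := E.exists_extension {x, y} (ind x)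
    refine ⟨u.1, ⟨E.toC u, u.2, rfl⟩, ?_⟩
    rw [hu x (by simp), hu y (by simp)]
    simp [ind, hxy.symm]
  obtain ⟨⟨f, hf⟩, h⟩ := ContinuousMap.exists_mem_subalgebra_near_continuousMap_of_separatesPoints
    A hsep g ε hε
  refine ⟨⟨f, hf⟩, fun x => ?_⟩
  rw [abs_sub_comm]
  exact lt_of_le_of_lt ((f - g).norm_coe_le_norm x) h

/-- Existence of the limits defining the scalar product of `w · du f₁` and `du f₂`. -/
def Good (w : Y → Y → ℝ) : Prop :=
  ∀ f₁ f₂ : E.dom, ∃ l, Tendsto (fun V => E.approxInner V (w * du f₁.1) (du f₂.1)) atTop (𝓝 l)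

lemma good_one : E.Good 1 := fun f₁ f₂ =>
  ⟨E.form f₁ f₂, (E.tendsto_tr f₁ f₂).congr fun V => by rw [one_mul, approxInner_du]⟩

lemma good_act_dom {w : Y → Y → ℝ} (hw : E.Good w) (g : E.dom) : E.Good (act g.1 w) := by
  intro f₁ f₂
  obtain ⟨a, ha⟩ := hw (E.mul g f₁) f₂
  obtain ⟨b, hb⟩ := hw (E.mul g f₂) f₁
  obtain ⟨c, hc⟩ := hw (E.mul f₁ f₂) g
  refine ⟨1 / 2 * (a + b - c), (((ha.add hb).sub hc).const_mul (1 / 2)).congr fun V => ?_⟩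
  simp only [approxInner, ← mul_add, ← mul_sub, ← Finset.sum_add_distrib,
    ← Finset.sum_sub_distrib]
  rw [← mul_assoc, mul_comm (1 / 2 : ℝ) (1 / 2), mul_assoc]
  congr 1
  simp only [Finset.mul_sum]
  refine Finset.sum_congr rfl fun p _ => Finset.sum_congr rfl fun q _ => ?_
  simp only [Pi.mul_apply, du, act, mul]
  ring

lemma good_act {w : Y → Y → ℝ} {K : ℝ} (hw : E.Good w) (hK : ∀ p q, |w p q| ≤ K)
    (g : C(Y, ℝ)) : E.Good (act g w) := by
  classical
  intro f₁ f₂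
  apply cauchySeq_tendsto_of_complete
  rw [Metric.cauchySeq_iff']
  intro ε hε
  set D := |K| * (E.form f₁ f₁ + E.form f₂ f₂) + 1 with hD
  have hDpos : 0 < D := by
    have := mul_nonneg (abs_nonneg K) (add_nonneg (E.nonneg f₁) (E.nonneg f₂))
    linarith
  obtain ⟨f, hf⟩ := E.exists_approx g (show 0 < ε / (4 * D) by positivity)
  obtain ⟨l, hl⟩ := E.good_act_dom hw f f₁ f₂
  have hcau := Metric.cauchySeq_iff'.1 hl.cauchySeq (ε / 2) (by positivity)
  obtain ⟨N, hN⟩ := hcau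
  refine ⟨N, fun V hV => ?_⟩
  have hdiff : ∀ V, |E.approxInner V (act g w * du f₁.1) (du f₂.1)
      - E.approxInner V (act f.1 w * du f₁.1) (du f₂.1)| ≤ ε / 4 := by
    intro V
    have e : E.approxInner V (act g w * du f₁.1) (du f₂.1)
      - E.approxInner V (act f.1 w * du f₁.1) (du f₂.1)
      = E.approxInner V ((act (⇑g - f.1) w) * du f₁.1) (du f₂.1) := by
      rw [sub_eq_iff_eq_add, ← approxInner_add_left]
      congr 1
      funext p q
      simp only [Pi.mul_apply, Pi.add_apply, act, Pi.sub_apply]; ring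
    rw [e]
    refine (E.approxInner_abs_le V (ε / (4 * D) * |K|) _ (fun p q => ?_) f₁ f₂).trans ?_
    · rw [act, abs_mul]
      refine mul_le_mul ?_ ((hK p q).trans (le_abs_self K)) (abs_nonneg _) (by positivity)
      have h1 := abs_lt.1 (hf p)
      have h2 := abs_lt.1 (hf q)
      simp only [Pi.sub_apply]
      rw [abs_le]; constructor <;> linarith
    · rw [mul_assoc]
      have : |K| * (E.form f₁ f₁ + E.form f₂ f₂) ≤ D := by rw [hD]; linarith
      calc ε / (4 * D) * (|K| * (E.form f₁ f₁ + E.form f₂ f₂)) ≤ ε / (4 * D) * D :=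
            mul_le_mul_of_nonneg_left this (by positivity)
        _ = ε / 4 := by field_simp
  have h1 := hN V hV
  rw [Real.dist_eq] at h1 ⊢
  have a1 := abs_le.1 (hdiff V)
  have a2 := abs_le.1 (hdiff N)
  have a3 := abs_lt.1 h1
  rw [abs_lt]; constructor <;> linarith

/-- The two-point function obtained from `v` by successive action of continuous functions. -/
def actList (gs : List C(Y, ℝ)) (v : Y → Y → ℝ) : Y → Y → ℝ := gs.foldr (fun g v => act g v) v

set_option linter.unusedSectionVars false in
lemma actList_eq (gs : List C(Y, ℝ)) (v : Y → Y → ℝ) : actList gs v = actList gs 1 * v := by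
  induction gs with
  | nil => simp [actList]
  | cons g gs ih =>
    change act g (actList gs v) = act g (actList gs 1) * v
    rw [ih]; funext p q; simp only [act, Pi.mul_apply]; ring

lemma actList_append (gs hs : List C(Y, ℝ)) :
    actList (gs ++ hs) (1 : Y → Y → ℝ) = actList gs 1 * actList hs 1 := by
  rw [← actList_eq]; simp [actList]

lemma abs_act_le (g : C(Y, ℝ)) (v : Y → Y → ℝ) (p q : Y) : |act g v p q| ≤ ‖g‖ * |v p q| := by
  rw [act, abs_mul]
  refine mul_le_mul_of_nonneg_right ?_ (abs_nonneg _)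
  have h1 := abs_le.1 (g.norm_coe_le_norm p)
  have h2 := abs_le.1 (g.norm_coe_le_norm q)
  rw [abs_le]; constructor <;> linarith

lemma exists_bound_actList (gs : List C(Y, ℝ)) :
    ∃ K : ℝ, ∀ p q, |actList gs (1 : Y → Y → ℝ) p q| ≤ K := by
  induction gs with
  | nil => exact ⟨1, fun p q => by simp [actList]⟩
  | cons g gs ih =>
    obtain ⟨K, hK⟩ := ih
    exact ⟨‖g‖ * K, fun p q => (abs_act_le g _ p q).trans
      (mul_le_mul_of_nonneg_left (hK p q) (norm_nonneg _))⟩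

lemma good_actList (gs : List C(Y, ℝ)) : E.Good (actList gs 1) := by
  induction gs with
  | nil => exact E.good_one
  | cons g gs ih =>
    obtain ⟨K, hK⟩ := exists_bound_actList gs
    exact E.good_act ih hK g

/-- The `C(Y)`-module generated by the universal derivatives `du f` of functions of finite
energy: finite linear combinations of the two-point functions obtained from some `du f` by
(possibly repeated) action of continuous functions. Repetition is allowed because the product of two
averages need not be an average; it does not change the completion below. -/
def oneForms : Submodule ℝ (Y → Y → ℝ) :=
  Submodule.span ℝ {v | ∃ (gs : List C(Y, ℝ)) (f : E.dom), v = actList gs (du f.1)}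

lemma exists_tendsto {v w : Y → Y → ℝ} (hv : v ∈ E.oneForms) (hw : w ∈ E.oneForms) :
    ∃ l, Tendsto (fun V => E.approxInner V v w) atTop (𝓝 l) := by
  induction hv using Submodule.span_induction with
  | mem v hv =>
    obtain ⟨gs, f, rfl⟩ := hv
    induction hw using Submodule.span_induction with
    | mem w hw =>
      obtain ⟨hs, g, rfl⟩ := hw
      obtain ⟨l, hl⟩ := E.good_actList (gs ++ hs) f g
      refine ⟨l, hl.congr fun V => ?_⟩
      rw [actList_append, actList_eq gs (du f.1), actList_eq hs (du g.1)]
      simp only [approxInner]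
      congr 1
      refine Finset.sum_congr rfl fun p _ => Finset.sum_congr rfl fun q _ => ?_
      simp only [Pi.mul_apply]; ring
    | zero => exact ⟨0, by simp [approxInner]⟩
    | add w w' _ _ h h' =>
      obtain ⟨l, hl⟩ := h
      obtain ⟨l', hl'⟩ := h'
      refine ⟨l + l', (hl.add hl').congr fun V => ?_⟩
      rw [E.approxInner_comm V _ (w + w'), approxInner_add_left, E.approxInner_comm V w,
        E.approxInner_comm V w']
    | smul r w _ h =>
      obtain ⟨l, hl⟩ := h
      refine ⟨r * l, (hl.const_mul r).congr fun V => ?_⟩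
      rw [E.approxInner_comm V _ (r • w), approxInner_smul_left, E.approxInner_comm V w]
  | zero => exact ⟨0, by simp [approxInner]⟩
  | add v v' _ _ h h' =>
    obtain ⟨l, hl⟩ := h
    obtain ⟨l', hl'⟩ := h'
    exact ⟨l + l', (hl.add hl').congr fun V => (E.approxInner_add_left V _ _ _).symm⟩
  | smul r v _ h =>
    obtain ⟨l, hl⟩ := h
    exact ⟨r * l, (hl.const_mul r).congr fun V => (E.approxInner_smul_left V r _ _).symm⟩

lemma act_mem (g : C(Y, ℝ)) {v : Y → Y → ℝ} (hv : v ∈ E.oneForms) : act g v ∈ E.oneForms := by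
  induction hv using Submodule.span_induction with
  | mem v hv =>
    obtain ⟨gs, f, rfl⟩ := hv
    exact Submodule.subset_span ⟨g :: gs, f, rfl⟩
  | zero =>
    have : act g (0 : Y → Y → ℝ) = 0 := by funext p q; simp [act]
    rw [this]; exact E.oneForms.zero_mem
  | add v w _ _ h h' =>
    have : act g (v + w) = act g v + act g w := by
      funext p q; simp only [act, Pi.add_apply]; ring
    rw [this]; exact E.oneForms.add_mem h h'
  | smul r v _ h =>
    have : act g (r • v) = r • act g v := by
      funext p q; simp only [act, Pi.smul_apply, smul_eq_mul]; ring
    rw [this]; exact E.oneForms.smul_mem r h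

/-- The space of one-forms, as a type. -/
def OneForm : Type _ := ↥E.oneForms

instance : AddCommGroup E.OneForm := inferInstanceAs (AddCommGroup ↥E.oneForms)
instance : Module ℝ E.OneForm := inferInstanceAs (Module ℝ ↥E.oneForms)

/-- The two-point function underlying a one-form. -/
def OneForm.val {E : CompactResistanceForm Y} (v : E.OneForm) : Y → Y → ℝ := Subtype.val v

/-- The (possibly degenerate) scalar product of one-forms: the limit, along the directed set of
all finite subsets `V`, of `1/2 ∑_{p, q ∈ V} c(V; p, q) v(p, q) w(p, q)`. The limit exists by
`exists_tendsto`; no particular exhausting sequence of finite sets has to be chosen. -/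
def ip (v w : E.OneForm) : ℝ := limUnder atTop fun V : Finset Y => E.approxInner V v.val w.val

lemma tendsto_ip (v w : E.OneForm) :
    Tendsto (fun V : Finset Y => E.approxInner V v.val w.val) atTop (𝓝 (E.ip v w)) :=
  tendsto_nhds_limUnder (E.exists_tendsto v.2 w.2)

lemma ip_eq {v w : E.OneForm} {l : ℝ}
    (h : Tendsto (fun V : Finset Y => E.approxInner V v.val w.val) atTop (𝓝 l)) :
    E.ip v w = l := by
  classical
  exact tendsto_nhds_unique (E.tendsto_ip v w) h

lemma ip_self_nonneg (v : E.OneForm) : 0 ≤ E.ip v v := by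
  classical
  exact ge_of_tendsto' (E.tendsto_ip v v) fun V => E.approxInner_self_nonneg V _

/-- The scalar product of one-forms, as a pre-inner product. -/
@[reducible]
def core : PreInnerProductSpace.Core ℝ E.OneForm where
  inner v w := E.ip v w
  conj_inner_symm v w := by
    simp only [conj_trivial]
    exact E.ip_eq ((E.tendsto_ip v w).congr fun V => E.approxInner_comm V _ _)
  re_inner_nonneg v := E.ip_self_nonneg v
  add_left u v w := E.ip_eq (((E.tendsto_ip u w).add (E.tendsto_ip v w)).congr fun V =>
    (E.approxInner_add_left V _ _ _).symm)
  smul_left v w r := by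
    simp only [conj_trivial]
    exact E.ip_eq (((E.tendsto_ip v w).const_mul r).congr fun V =>
      (E.approxInner_smul_left V _ _ _).symm)

instance : SeminormedAddCommGroup E.OneForm :=
  @InnerProductSpace.Core.toSeminormedAddCommGroup ℝ E.OneForm _ _ _ E.core

instance : InnerProductSpace ℝ E.OneForm := InnerProductSpace.ofCore E.core

lemma inner_eq_ip (v w : E.OneForm) : inner ℝ v w = E.ip v w := rfl

lemma norm_sq_eq_ip (v : E.OneForm) : ‖v‖ ^ 2 = E.ip v v := by
  rw [← real_inner_self_eq_norm_sq]; rfl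

/-- The Hilbert space of generalized `L²` vector fields: the (Hausdorff) completion of the space of
one-forms. -/
abbrev VectorField : Type _ := UniformSpace.Completion E.OneForm

/-- The class of `du f`, as a one-form. -/
def duForm (f : E.dom) : E.OneForm :=
  ⟨du f.1, Submodule.subset_span ⟨[], f, rfl⟩⟩

/-- The gradient. -/
def grad (f : E.dom) : E.VectorField := (E.duForm f : E.OneForm)

lemma norm_grad_sq (f : E.dom) : ‖E.grad f‖ ^ 2 = E.form f f := by
  rw [grad, UniformSpace.Completion.norm_coe, norm_sq_eq_ip]
  exact E.ip_eq ((E.tendsto_tr_self f).congr fun V => (E.approxInner_du V _ _).symm)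

/-- The action of a continuous function on one-forms. -/
def actForm (g : C(Y, ℝ)) : E.OneForm →ₗ[ℝ] E.OneForm where
  toFun v := ⟨act g v.val, E.act_mem g v.2⟩
  map_add' v w := Subtype.ext (by
    funext p q
    change (g p + g q) / 2 * (v.val p q + w.val p q) = act g v.val p q + act g w.val p q
    simp only [act]; ring)
  map_smul' r v := Subtype.ext (by
    funext p q
    change (g p + g q) / 2 * (r * v.val p q) = r * act g v.val p q
    simp only [act]; ring)

lemma norm_actForm_le (g : C(Y, ℝ)) (v : E.OneForm) : ‖E.actForm g v‖ ≤ ‖g‖ * ‖v‖ := by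
  classical
  refine abs_le_of_sq_le_sq' ?_ (by positivity) |>.2
  rw [mul_pow, norm_sq_eq_ip, norm_sq_eq_ip]
  refine le_of_tendsto_of_tendsto' (E.tendsto_ip _ _) ((E.tendsto_ip v v).const_mul _) fun V => ?_
  have h : E.approxInner V (‖g‖ • v.val) (‖g‖ • v.val) = ‖g‖ ^ 2 * E.approxInner V v.val v.val := by
    rw [approxInner_smul_left, approxInner_comm, approxInner_smul_left]; ring
  rw [← h]
  refine E.approxInner_mono fun p q => ?_
  have := abs_act_le g v.val p q
  rw [← sq_abs, ← sq_abs ((‖g‖ • v.val) p q)]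
  refine pow_le_pow_left₀ (abs_nonneg _) ?_ 2
  rw [Pi.smul_apply, Pi.smul_apply, smul_eq_mul, abs_mul, abs_norm]
  exact this

/-- The action of a continuous function on vector fields, `v ↦ g · v`. -/
def mulField (g : C(Y, ℝ)) : E.VectorField →L[ℝ] E.VectorField :=
  ((E.actForm g).mkContinuous ‖g‖ (E.norm_actForm_le g)).completion

lemma mulField_coe (g : C(Y, ℝ)) (v : E.OneForm) :
    E.mulField g (v : E.VectorField) = (E.actForm g v : E.OneForm) :=
  UniformSpace.Completion.map_coe
    ((E.actForm g).mkContinuous ‖g‖ (E.norm_actForm_le g)).uniformContinuous v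


/-! ### Energy measures, diameters, harmonic functions -/

/-- `ν` is the energy measure of `f`. -/
def IsEnergyMeasure [MeasurableSpace Y] (f : E.dom) (ν : Measure Y) : Prop :=
  IsFiniteMeasure ν ∧ ∀ g : E.dom,
    ∫ x, g.1 x ∂ν = E.form (E.mul f g) f - 1 / 2 * E.form (E.mul f f) g

/-- The diameter of a set in the resistance metric. -/
def rdiam (s : Set Y) : ℝ≥0∞ := ⨆ x ∈ s, ⨆ y ∈ s, ENNReal.ofReal (E.resistance x y)

/-- The functions of finite energy that minimize the energy among all functions with the same
values on `W`. -/
def harmonic (W : Set Y) : Set E.dom :=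
  {u | ∀ w : E.dom, (∀ x ∈ W, w.1 x = u.1 x) → E.form u u ≤ E.form w w}

/-! ### Elliptic and parabolic equations -/

section Equations

variable [MeasurableSpace Y] [BorelSpace Y] [SecondCountableTopology Y]
  (μ : Measure Y) [IsFiniteMeasure μ]

/-- A function of finite energy, as an element of `L²`. -/
def toL2 : E.dom →ₗ[ℝ] Lp ℝ 2 μ := (ContinuousMap.toLp 2 μ ℝ).toLinearMap ∘ₗ E.toC

/-- The representative of finite energy of an element of `L²` (meaningful if it has one; it is
unique if `μ` charges every nonempty open set). -/
def rep : Lp ℝ 2 μ → E.dom := Function.invFun (E.toL2 μ)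

/-- The form `𝓔₁ = 𝓔 + ‖·‖²`. -/
def energyOne (u : E.dom) : ℝ := E.form u u + ‖E.toL2 μ u‖ ^ 2

/-- The bilinear form
`Q(f, g) = ⟨a · ∂f, ∂g⟩ - ⟨g · b, ∂f⟩ - ⟨f · b', ∂g⟩ - ⟨c f, g⟩`. -/
def bilin (a : C(Y, ℝ)) (b b' : E.VectorField) (c : C(Y, ℝ)) (f g : E.dom) : ℝ :=
  inner ℝ (E.mulField a (E.grad f)) (E.grad g) - inner ℝ (E.mulField (E.toC g) b) (E.grad f)
    - inner ℝ (E.mulField (E.toC f) b') (E.grad g) - ∫ x, c x * f.1 x * g.1 x ∂μ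

/-- `u` is a weak solution of `L u = f`, where `L` is the generator of the form `Q`. -/
def IsWeakSolution (a : C(Y, ℝ)) (b b' : E.VectorField) (c : C(Y, ℝ)) (f : Lp ℝ 2 μ)
    (u : E.dom) : Prop :=
  ∀ g : E.dom, E.bilin μ a b b' c u g = - inner ℝ f (E.toL2 μ g)

/-- The graph of the generator `L` of the form `Q`: `u` is in the domain of `L` and `L u = w`. -/
def IsGenerator (a : C(Y, ℝ)) (b b' : E.VectorField) (c : C(Y, ℝ)) (u w : Lp ℝ 2 μ) : Prop :=
  ∃ f : E.dom, E.toL2 μ f = u ∧ ∀ g : E.dom, E.bilin μ a b b' c f g = - inner ℝ w (E.toL2 μ g)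

/-- `u` is a solution of the Cauchy problem `u'(t) = L u(t)` for `t > 0`, `u(0) = u₀`, where `L` is
the generator of the form `Q`. -/
structure IsCauchySolution (a : C(Y, ℝ)) (b b' : E.VectorField) (c : C(Y, ℝ)) (u₀ : Lp ℝ 2 μ)
    (u : ℝ → Lp ℝ 2 μ) : Prop where
  continuousOn : ContinuousOn u (Set.Ici 0)
  contDiffOn : ContDiffOn ℝ 1 u (Set.Ioi 0)
  eq : ∀ t > 0, E.IsGenerator μ a b b' c (u t) (deriv u t)
  init : u 0 = u₀

end Equations

end CompactResistanceForm

/-! ### Finitely ramified sets and approximating spaces -/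

/-- A finitely ramified cell structure, with cells `cell α` and finite boundaries `vert α`, and with
the cells of generation `n` indexed by `level n`. -/
structure FinitelyRamified (X A : Type*) [TopologicalSpace X] where
  cell : A → Set X
  vert : A → Set X
  level : ℕ → Finset A
  root : A
  cell_injective : Function.Injective cell
  isCompact_cell : ∀ α, IsCompact (cell α)
  isConnected_cell : ∀ α, IsConnected (cell α)
  finite_vert : ∀ α, (vert α).Finite
  vert_subset : ∀ α, vert α ⊆ cell α
  vert_subset_of_union : ∀ (α : A) (s : Finset A), cell α = ⋃ β ∈ s, cell β →
    vert α ⊆ ⋃ β ∈ s, vert β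
  level_zero : level 0 = {root}
  cell_root : cell root = Set.univ
  level_disjoint : ∀ n m, n ≠ m → Disjoint (level n) (level m)
  refine : ∀ n, ∀ α ∈ level n, ∃ s ⊆ level (n + 1), cell α = ⋃ β ∈ s, cell β
  inter_eq : ∀ n, ∀ α ∈ level n, ∀ β ∈ level n, α ≠ β → cell α ∩ cell β = vert α ∩ vert β
  inter_singleton : ∀ s : ℕ → A, (∀ n, cell (s (n + 1)) ⊂ cell (s n)) →
    ∃ x, ⋂ n, cell (s n) = {x}

/-- The set `V_n` of vertices of generation `n`. -/
def FinitelyRamified.vertices {X A : Type*} [TopologicalSpace X] (C : FinitelyRamified X A)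
    (n : ℕ) : Set X := ⋃ α ∈ C.level n, C.vert α

/-- A sequence of compact approximating spaces `carrier m = X^(m)` of a finitely ramified set, each
a union of sets `subcell m α` with `V_α ⊆ subcell m α ⊆ X_α`, and each carrying a resistance form
whose resistance metric induces the subspace topology. -/
structure ApproxSpaces {X A : Type*} [TopologicalSpace X] (C : FinitelyRamified X A) where
  carrier : ℕ → Set X
  subcell : ℕ → A → Set X
  monotone : ∀ m, carrier m ⊆ carrier (m + 1)
  carrier_eq : ∀ m, carrier m = ⋃ α ∈ C.level m, subcell m α
  vert_subset : ∀ m, ∀ α ∈ C.level m, C.vert α ⊆ subcell m α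
  subcell_subset : ∀ m, ∀ α ∈ C.level m, subcell m α ⊆ C.cell α
  [compactSpace : ∀ m, CompactSpace (carrier m)]
  energy : ∀ m, CompactResistanceForm (carrier m)

namespace ApproxSpaces

attribute [instance] ApproxSpaces.compactSpace

variable {X A : Type*} [MetricSpace X] [CompactSpace X] {C : FinitelyRamified X A}
  (S : ApproxSpaces C) (E : CompactResistanceForm X)

/-- The space `H_m(X)` of `m`-harmonic functions on `X`. -/
def harmonicX (C : FinitelyRamified X A) (E : CompactResistanceForm X) (m : ℕ) : Set E.dom :=
  E.harmonic (C.vertices m)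

/-- The space `H_m(X^(m))` of restrictions to `X^(m)` of `m`-harmonic functions on `X`. -/
def harmonicRestr (m : ℕ) : Set (S.energy m).dom :=
  {v | ∃ u ∈ harmonicX C E m, ∀ x : S.carrier m, v.1 x = u.1 x}

/-- The extension `ext_m`, the inverse of the restriction map from `H_m(X)` to `H_m(X^(m))`. -/
def ext (m : ℕ) (v : (S.energy m).dom) : E.dom :=
  Function.invFunOn (fun (u : E.dom) (x : S.carrier m) => u.1 x) (harmonicX C E m) v.1

/-- The energies on the approximating spaces agree with the energy on `X` for `m`-harmonic
functions, and the energy measures converge weakly. -/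
structure HarmonicCompatible [MeasurableSpace X] : Prop where
  /-- restrictions of `m`-harmonic functions to `X^(m)` have finite energy, equal to the original
  one -/
  restrict : ∀ m, ∀ u ∈ harmonicX C E m, ∃ v : (S.energy m).dom,
    (∀ x : S.carrier m, v.1 x = u.1 x) ∧ (S.energy m).form v v = E.form u u
  injective : ∀ m, Set.InjOn (fun (u : E.dom) (x : S.carrier m) => u.1 x) (harmonicX C E m)
  /-- `ν_u` is the weak limit of the energy measures of the restrictions `v m` of the `m`-harmonic
  functions `h m` which agree with `u` on `V_m` -/
  energyMeasure : ∀ (u : E.dom) (ν : Measure X), E.IsEnergyMeasure u ν →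
    ∀ (h : ℕ → E.dom) (v : ∀ m, (S.energy m).dom) (νm : ∀ m, Measure (S.carrier m)),
    (∀ m, h m ∈ harmonicX C E m ∧ (∀ x ∈ C.vertices m, (h m).1 x = u.1 x) ∧
      (∀ x : S.carrier m, (v m).1 x = (h m).1 x) ∧
      (S.energy m).IsEnergyMeasure (v m) (νm m)) →
    ∀ g : C(X, ℝ), Tendsto (fun m => ∫ x : S.carrier m, g x ∂(νm m)) atTop (𝓝 (∫ x, g x ∂ν))

/-- `H m` is a linear projection of the functions of finite energy on `X^(m)` onto `H_m(X^(m))`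
which is orthogonal with respect to the energy. -/
structure IsHarmonicProjection (H : ∀ m, (S.energy m).dom →ₗ[ℝ] (S.energy m).dom) : Prop where
  mem : ∀ m v, H m v ∈ S.harmonicRestr E m
  apply_eq : ∀ m, ∀ v ∈ S.harmonicRestr E m, H m v = v
  orthogonal : ∀ m v, ∀ w ∈ S.harmonicRestr E m, (S.energy m).form (v - H m v) w = 0

/-- Decay of the deviation of functions of finite energy from their projections. -/
structure ProjectionDecay (H : ∀ m, (S.energy m).dom →ₗ[ℝ] (S.energy m).dom) : Prop where
  sup : ∀ u : ∀ m, (S.energy m).dom,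
    BddAbove (Set.range fun m => (S.energy m).form (u m) (u m)) →
    Tendsto (fun m => ‖(S.energy m).toC (u m - H m (u m))‖) atTop (𝓝 0)
  /-- `p m` is the product of the restrictions of two `n`-harmonic functions to `X^(m)` -/
  product : ∀ n, ∀ u ∈ harmonicX C E n, ∀ w ∈ harmonicX C E n, ∀ p : ∀ m, (S.energy m).dom,
    (∀ m ≥ n, ∀ x : S.carrier m, (p m).1 x = u.1 x * w.1 x) →
    Tendsto (fun m => (S.energy m).form (p m - H m (p m)) (p m - H m (p m))) atTop (𝓝 0)

section Measures

variable [MeasurableSpace X] [BorelSpace X]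
  (μ : Measure X) [IsFiniteMeasure μ]
  (μm : ∀ m, Measure (S.carrier m)) [∀ m, IsFiniteMeasure (μm m)]

/-- The measures `μ` and `μ^(m)` admit the uniform lower bound `V` on the cells of generation
`m`. -/
structure UniformLowerBound (V : ℕ → ℝ) : Prop where
  antitone : Antitone V
  pos : ∀ m, 0 < V m
  le_cell : ∀ m, ∀ α ∈ C.level m, V m ≤ μ.real (C.cell α)
  le_subcell : ∀ m, ∀ α ∈ C.level m, V m ≤ (μm m).real (Subtype.val ⁻¹' S.subcell m α)

/-- The restriction to `X^(m)` of a function of finite energy on `X`, as an element of `L²`. -/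
def restrictL2 (m : ℕ) (u : E.dom) : Lp ℝ 2 (μm m) :=
  ContinuousMap.toLp 2 (μm m) ℝ ((E.toC u).restrict (S.carrier m))

/-- The operators `Φ m : L²(X, μ) → L²(X^(m), μ^(m))` connect the `L²`-spaces, consistently with
pointwise restrictions and with the projections `H m`. -/
structure Connection (H : ∀ m, (S.energy m).dom →ₗ[ℝ] (S.energy m).dom)
    (Φ : ∀ m, Lp ℝ 2 μ →L[ℝ] Lp ℝ 2 (μm m)) : Prop where
  bounded : BddAbove (Set.range fun m => ‖Φ m‖)
  tendsto_norm : ∀ u, Tendsto (fun m => ‖Φ m u‖) atTop (𝓝 ‖u‖)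
  tendsto_adjoint : ∀ n, ∀ u ∈ harmonicX C E n,
    Tendsto (fun m => ‖(Φ m).adjoint (Φ m (E.toL2 μ u)) - E.toL2 μ u‖) atTop (𝓝 0)
  restrict : ∀ u : ℕ → E.dom, BddAbove (Set.range fun m => E.form (u m) (u m)) →
    Tendsto (fun m => ‖Φ m (E.toL2 μ (u m)) - S.restrictL2 E μm m (u m)‖) atTop (𝓝 0)
  extension : ∀ u : ∀ m, (S.energy m).dom,
    BddAbove (Set.range fun m => (S.energy m).energyOne (μm m) (u m)) →
    BddAbove (Set.range fun m => ‖E.toL2 μ (S.ext E m (H m (u m)))‖)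

end Measures

/-- The index `n₀` is admissible for the bound `B = sup_m ‖b^(m)‖²` and the parameter `M`: for all
`m ≥ n₀` the parts in `X^(m)` of the cells of generation `n₀` have `R^(m)`-diameter at most
`1 / (4 M B)`. -/
def Admissible (M B : ℝ) (n₀ : ℕ) : Prop :=
  ∀ m ≥ n₀, ∀ α ∈ C.level n₀,
    (S.energy m).rdiam (Subtype.val ⁻¹' C.cell α) * ENNReal.ofReal (4 * M * B) ≤ 1

/-- The constant `γ_M = 2 / V(n₀) * sup_{m ≥ n₀} ‖b^(m)‖²`. -/
def gammaConst (V : ℕ → ℝ) (b : ∀ m, (S.energy m).VectorField) (n₀ : ℕ) : ℝ :=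
  2 / V n₀ * ⨆ m : {m // n₀ ≤ m}, ‖b m‖ ^ 2

end ApproxSpaces

end

/-! Both assertions are compactness statements resting on energy bounds uniform in m. If `energyOne`
of u_m stays bounded, then so does the energy of ext_m H_m u_m, because H_m is an energy-orthogonal
projection and restriction preserves the energy of m-harmonic functions; the L² norms are bounded by
the `extension` hypothesis. An energy bound is a Hölder-1/2 bound in the resistance metric, and
together with an L² bound it gives a uniform sup bound, so Arzelà–Ascoli yields a uniformly
convergent subsequence (`exists_tendstoUniformly_subseq`, `exists_tendstoUniformly_ext`).

The uniform bounds come from coercivity and boundedness of Q^(m) with constants independent of m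
(`exists_uniform_bilin`). The drift terms are controlled by ‖f·b‖ ≤ ‖f‖_sup ‖b‖ and a pointwise
bound of f² by a small multiple of the energy plus a multiple of ‖f‖² (`eventually_sq_le`). That
bound averages f over a neighbourhood of a cell of the fixed generation n. The mass needed there
must not deteriorate with m: the lower bound on μ^(m) concerns cells of generation m only, so the
mass is carried over from μ by a cut-off function and the operators Φ_m (`exists_cutoff_mass`).

For the elliptic equation, testing with the solution itself bounds its energy. For the parabolic
one, u(t) solves the elliptic equation with right-hand side u'(t), and the smoothing estimate
t‖u'(t)‖ ≤ const·‖u(0)‖ for coercive bounded forms (`norm_deriv_le_of_cauchy`) reduces it to the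
elliptic case. -/

namespace CompactResistanceForm

open ResistanceForm

/-! ### Calculus of vector fields and cut-off functions. -/

section General

variable {Y : Type*} [TopologicalSpace Y] [CompactSpace Y] (E : CompactResistanceForm Y)

lemma norm_mulField_le (g : C(Y, ℝ)) (v : E.VectorField) : ‖E.mulField g v‖ ≤ ‖g‖ * ‖v‖ := by
  induction v using UniformSpace.Completion.induction_on with
  | hp => exact isClosed_le (by fun_prop) (by fun_prop)
  | ih v =>
    rw [mulField_coe, UniformSpace.Completion.norm_coe, UniformSpace.Completion.norm_coe]
    exact E.norm_actForm_le g v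

lemma mulField_add_left (g h : C(Y, ℝ)) (v : E.VectorField) :
    E.mulField (g + h) v = E.mulField g v + E.mulField h v := by
  induction v using UniformSpace.Completion.induction_on with
  | hp => exact isClosed_eq (by fun_prop) (by fun_prop)
  | ih v =>
    simp only [mulField_coe, ← UniformSpace.Completion.coe_add]
    congr 1
    refine Subtype.ext ?_
    funext p q
    change ((g + h) p + (g + h) q) / 2 * v.val p q
      = (g p + g q) / 2 * v.val p q + (h p + h q) / 2 * v.val p q
    simp only [ContinuousMap.add_apply]; ring

lemma mulField_smul_left (r : ℝ) (g : C(Y, ℝ)) (v : E.VectorField) :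
    E.mulField (r • g) v = r • E.mulField g v := by
  induction v using UniformSpace.Completion.induction_on with
  | hp => exact isClosed_eq (E.mulField (r • g)).continuous ((E.mulField g).continuous.const_smul r)
  | ih v =>
    simp only [mulField_coe, ← UniformSpace.Completion.coe_smul]
    congr 1
    refine Subtype.ext ?_
    funext p q
    change ((r • g) p + (r • g) q) / 2 * v.val p q = r * ((g p + g q) / 2 * v.val p q)
    simp only [ContinuousMap.smul_apply, smul_eq_mul]; ring

/-- Multiplication by a function bounded below by `r` is bounded below by `r`. -/
lemma le_inner_mulField {a : C(Y, ℝ)} {r : ℝ} (ha : ∀ x, r ≤ a x) (v : E.VectorField) :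
    r * ‖v‖ ^ 2 ≤ inner ℝ (E.mulField a v) v := by
  classical
  induction v using UniformSpace.Completion.induction_on with
  | hp => exact isClosed_le (by fun_prop) (by fun_prop)
  | ih v =>
    rw [mulField_coe, UniformSpace.Completion.norm_coe, UniformSpace.Completion.inner_coe,
      norm_sq_eq_ip, inner_eq_ip]
    -- On each finite set the comparison is termwise: the weights are nonnegative and the average of
    -- two values of `a` is at least `r`. Limits and density then carry it to the completion.
    refine le_of_tendsto_of_tendsto' ((E.tendsto_ip v v).const_mul r)
      (E.tendsto_ip (E.actForm a v) v) fun V => ?_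
    rw [approxInner, approxInner, mul_left_comm]
    refine mul_le_mul_of_nonneg_left ?_ (by norm_num)
    rw [Finset.mul_sum]
    refine Finset.sum_le_sum fun p hp => ?_
    rw [Finset.mul_sum]
    refine Finset.sum_le_sum fun q hq => ?_
    change r * (E.weight V p q * v.val p q * v.val p q)
      ≤ E.weight V p q * ((a p + a q) / 2 * v.val p q) * v.val p q
    have h1 : 0 ≤ E.weight V p q * (v.val p q * v.val p q) :=
      mul_nonneg (E.weight_nonneg V hp hq) (mul_self_nonneg _)
    nlinarith [ha p, ha q]

lemma grad_add (f g : E.dom) : E.grad (f + g) = E.grad f + E.grad g := by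
  simp only [grad, ← UniformSpace.Completion.coe_add]
  congr 1
  refine Subtype.ext ?_
  funext p q
  change (f.1 p + g.1 p) - (f.1 q + g.1 q) = (f.1 p - f.1 q) + (g.1 p - g.1 q)
  ring

lemma grad_smul (r : ℝ) (f : E.dom) : E.grad (r • f) = r • E.grad f := by
  simp only [grad, ← UniformSpace.Completion.coe_smul]
  congr 1
  refine Subtype.ext ?_
  funext p q
  change r * f.1 p - r * f.1 q = r * (f.1 p - f.1 q)
  ring

lemma norm_grad (f : E.dom) : ‖E.grad f‖ = √(E.form f f) := by
  rw [← norm_grad_sq, Real.sqrt_sq (norm_nonneg _)]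

lemma abs_sub_le (u : E.dom) (x y : Y) :
    |u.1 x - u.1 y| ≤ √(E.resistance x y) * √(E.form u u) := by
  rw [← Real.sqrt_mul (E.resistance_nonneg x y), ← Real.sqrt_sq_eq_abs]
  exact Real.sqrt_le_sqrt (E.sq_sub_le u x y)

lemma resistance_nhds (x : Y) {r : ℝ} (hr : 0 < r) : {y | E.resistance x y < r} ∈ 𝓝 x :=
  (E.nhds_basis x).mem_of_mem hr

/-- A cut-off function of finite energy. -/
lemma exists_cutoff [NormalSpace Y] {s U : Set Y} (hs : IsClosed s) (hU : IsOpen U)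
    (hsU : s ⊆ U) :
    ∃ w : E.dom, (∀ x, 0 ≤ w.1 x ∧ w.1 x ≤ 1) ∧ (∀ x ∈ s, w.1 x = 1) ∧ ∀ x ∉ U, w.1 x = 0 := by
  obtain ⟨g, hg0, hg1, -⟩ := exists_continuous_zero_one_of_isClosed hU.isClosed_compl hs
    (Set.disjoint_left.2 fun x hx hxs => hx (hsU hxs))
  -- A Urysohn function need not have finite energy. For an approximation within 1/4, the function
  -- 2f - 1/2 exceeds 1 where g = 1 and is negative where g = 0, so truncation to [0, 1] restores
  -- the exact values.
  obtain ⟨f, hf⟩ := E.exists_approx g (ε := 1 / 4) (by norm_num)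
  obtain ⟨w, hw, -⟩ := E.unit_contraction ((2 : ℝ) • f + E.const (-(1 / 2)))
  have hw' : ∀ x, w.1 x = max 0 (min 1 (2 * f.1 x - 1 / 2)) := fun x => by
    rw [hw]; rfl
  refine ⟨w, fun x => ?_, fun x hx => ?_, fun x hx => ?_⟩
  · rw [hw']
    exact ⟨le_max_left _ _, max_le zero_le_one (min_le_left _ _)⟩
  · have h1 : g x = 1 := hg1 hx
    have h2 := abs_lt.1 (hf x)
    rw [hw', min_eq_left (by linarith), max_eq_right zero_le_one]
  · have h1 : g x = 0 := hg0 hx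
    have h2 := abs_lt.1 (hf x)
    rw [hw', max_eq_left ((min_le_right _ _).trans (by linarith))]

end General

/-! ### Coercivity and boundedness of the form Q on a single space. -/

section Measure

variable {Y : Type*} [TopologicalSpace Y] [CompactSpace Y] [MeasurableSpace Y] [BorelSpace Y]

lemma _root_.Continuous.integrable_of_compactSpace (μ : Measure Y) [IsFiniteMeasure μ] {f : Y → ℝ}
    (hf : Continuous f) : Integrable f μ :=
  hf.integrable_of_hasCompactSupport (HasCompactSupport.of_compactSpace f)

variable [SecondCountableTopology Y] (E : CompactResistanceForm Y)
  (μ : Measure Y) [IsFiniteMeasure μ]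

set_option linter.unusedSectionVars false

lemma inner_toL2 (f g : E.dom) : inner ℝ (E.toL2 μ f) (E.toL2 μ g) = ∫ x, f.1 x * g.1 x ∂μ := by
  have := ContinuousMap.inner_toLp (𝕜 := ℝ) μ (E.toC f) (E.toC g)
  refine this.trans (integral_congr_ae (ae_of_all _ fun x => ?_))
  simp [mul_comm]

lemma norm_toL2_sq (f : E.dom) : ‖E.toL2 μ f‖ ^ 2 = ∫ x, f.1 x ^ 2 ∂μ := by
  rw [← real_inner_self_eq_norm_sq, inner_toL2]
  simp only [sq]

lemma toL2_injective [μ.IsOpenPosMeasure] : Function.Injective (E.toL2 μ) := by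
  intro f g h
  have := ContinuousMap.toLp_injective (p := 2) (𝕜 := ℝ) μ h
  exact Subtype.ext (congrArg (fun h : C(Y, ℝ) => (h : Y → ℝ)) this)

lemma rep_toL2 [μ.IsOpenPosMeasure] (f : E.dom) : E.rep μ (E.toL2 μ f) = f :=
  Function.leftInverse_invFun (E.toL2_injective μ) f

lemma bilin_add_left (a : C(Y, ℝ)) (b b' : E.VectorField) (c : C(Y, ℝ)) (f f' g : E.dom) :
    E.bilin μ a b b' c (f + f') g = E.bilin μ a b b' c f g + E.bilin μ a b b' c f' g := by
  have h : ∫ x, c x * (f + f').1 x * g.1 x ∂μ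
      = ∫ x, c x * f.1 x * g.1 x ∂μ + ∫ x, c x * f'.1 x * g.1 x ∂μ := by
    have hf := E.continuous_dom f
    have hf' := E.continuous_dom f'
    have hg := E.continuous_dom g
    rw [← integral_add (Continuous.integrable_of_compactSpace μ (by fun_prop))
      (Continuous.integrable_of_compactSpace μ (by fun_prop))]
    refine integral_congr_ae (ae_of_all _ fun x => ?_)
    simp only [Submodule.coe_add, Pi.add_apply]; ring
  simp only [bilin, h, grad_add, map_add, mulField_add_left,
    inner_add_left, inner_add_right]
  ring

lemma bilin_smul_left (a : C(Y, ℝ)) (b b' : E.VectorField) (c : C(Y, ℝ)) (r : ℝ) (f g : E.dom) :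
    E.bilin μ a b b' c (r • f) g = r * E.bilin μ a b b' c f g := by
  have h : ∫ x, c x * (r • f).1 x * g.1 x ∂μ = r * ∫ x, c x * f.1 x * g.1 x ∂μ := by
    rw [← integral_const_mul]
    refine integral_congr_ae (ae_of_all _ fun x => ?_)
    simp only [Submodule.coe_smul, Pi.smul_apply, smul_eq_mul]; ring
  simp only [bilin, h, grad_smul, map_smul, mulField_smul_left,
    inner_smul_left, inner_smul_right, conj_trivial]
  ring

lemma bilin_sub_left (a : C(Y, ℝ)) (b b' : E.VectorField) (c : C(Y, ℝ)) (f f' g : E.dom) :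
    E.bilin μ a b b' c (f - f') g = E.bilin μ a b b' c f g - E.bilin μ a b b' c f' g := by
  have h := E.bilin_add_left μ a b b' c (f - f') f' g
  rw [sub_add_cancel] at h
  linarith

lemma energyOne_nonneg (f : E.dom) : 0 ≤ E.energyOne μ f :=
  add_nonneg (E.nonneg f) (sq_nonneg _)

/-- Coercivity of the form `Q`, given relative bounds for the drift terms. -/
lemma coercive_bilin {a c : C(Y, ℝ)} {b b' : E.VectorField} {lam M G G' c₀ : ℝ}
    (hM : 0 < M) (hlam : 0 < lam - 2 / √M) (ha : ∀ x, lam ≤ a x) (hc : ∀ x, c₀ ≤ -c x)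
    (hG : 0 ≤ G) (hG' : 0 ≤ G') (hc₀ : 0 < c₀)
    {f : E.dom}
    (hb : ‖E.mulField (E.toC f) b‖ ^ 2 ≤ E.form f f / M + 2 * G * ‖E.toL2 μ f‖ ^ 2)
    (hb' : ‖E.mulField (E.toC f) b'‖ ^ 2 ≤ E.form f f / M + 2 * G' * ‖E.toL2 μ f‖ ^ 2) :
    (c₀ * (lam - 2 / √M) - (G + G')) / (lam - 2 / √M + c₀) * E.energyOne μ f
      ≤ E.bilin μ a b b' c f f := by
  have hx : √(E.form f f) ^ 2 = E.form f f := Real.sq_sqrt (E.nonneg f)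
  have hx0 : 0 ≤ √(E.form f f) := Real.sqrt_nonneg _
  -- Since √(A² + B²) ≤ A + B, each drift term costs at most x²/√M plus a mixed term, where x² is
  -- the energy. The two together lower the ellipticity constant from `lam` to `lam - 2 / √M`.
  have hdrift : ∀ (v : E.VectorField) (D : ℝ), 0 ≤ D →
      ‖E.mulField (E.toC f) v‖ ^ 2 ≤ E.form f f / M + 2 * D * ‖E.toL2 μ f‖ ^ 2 →
      inner ℝ (E.mulField (E.toC f) v) (E.grad f)
        ≤ (√(E.form f f) / √M + √(2 * D) * ‖E.toL2 μ f‖) * √(E.form f f) := by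
    intro v D hD hv
    refine (real_inner_le_norm _ _).trans ?_
    rw [norm_grad]
    refine mul_le_mul_of_nonneg_right ?_ hx0
    refine abs_le_of_sq_le_sq' (hv.trans ?_) (by positivity) |>.2
    have h1 : (√(E.form f f) / √M) ^ 2 = E.form f f / M := by
      rw [div_pow, hx, Real.sq_sqrt hM.le]
    have h2 : (√(2 * D) * ‖E.toL2 μ f‖) ^ 2 = 2 * D * ‖E.toL2 μ f‖ ^ 2 := by
      rw [mul_pow, Real.sq_sqrt (by positivity)]
    have h3 : 0 ≤ (√(E.form f f) / √M) * (√(2 * D) * ‖E.toL2 μ f‖) := by positivity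
    nlinarith
  have e1 := hdrift b G hG hb
  have e2 := hdrift b' G' hG' hb'
  have e3 := E.le_inner_mulField ha (E.grad f)
  rw [norm_grad_sq] at e3
  have e4 : c₀ * ‖E.toL2 μ f‖ ^ 2 ≤ - ∫ x, c x * f.1 x * f.1 x ∂μ := by
    have hf := E.continuous_dom f
    rw [norm_toL2_sq, ← integral_const_mul, ← integral_neg]
    refine integral_mono (Continuous.integrable_of_compactSpace μ (by fun_prop))
      (Continuous.integrable_of_compactSpace μ (by fun_prop)) fun x => ?_
    have := mul_le_mul_of_nonneg_right (hc x) (sq_nonneg (f.1 x))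
    simp only
    linarith
  set p := lam - 2 / √M with hp
  set x := √(E.form f f)
  set y := ‖E.toL2 μ f‖
  have hy0 : 0 ≤ y := norm_nonneg _
  -- It remains to see that p x² - k x y + c₀ y² ≥ δ (x² + y²). The choice of δ gives (p - δ)(c₀ -
  -- δ) = G + G' + δ², and k² ≤ 4(G + G'), so the discriminant of the difference is nonpositive.
  set δ := (c₀ * p - (G + G')) / (p + c₀) with hδ
  have hδ' : δ * (p + c₀) = c₀ * p - (G + G') := by rw [hδ]; field_simp
  set k := √(2 * G) + √(2 * G')
  have hk : k ^ 2 ≤ 4 * (G + G') := by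
    have h1 : √(2 * G) ^ 2 = 2 * G := Real.sq_sqrt (by positivity)
    have h2 : √(2 * G') ^ 2 = 2 * G' := Real.sq_sqrt (by positivity)
    nlinarith [sq_nonneg (√(2 * G) - √(2 * G'))]
  have hA : 0 < p - δ := by
    have : 0 < (p - δ) * (p + c₀) := by nlinarith
    exact pos_of_mul_pos_left this (by linarith)
  have hquad : 0 ≤ (p - δ) * x ^ 2 - k * x * y + (c₀ - δ) * y ^ 2 := by
    have h1 : k ^ 2 ≤ 4 * ((p - δ) * (c₀ - δ)) := by nlinarith [sq_nonneg δ]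
    have h2 : 0 ≤ 4 * (p - δ) * ((p - δ) * x ^ 2 - k * x * y + (c₀ - δ) * y ^ 2) := by
      have := mul_le_mul_of_nonneg_right h1 (sq_nonneg y)
      nlinarith [sq_nonneg (2 * (p - δ) * x - k * y)]
    exact nonneg_of_mul_nonneg_right h2 (by linarith)
  have e5 : lam * x ^ 2 - 2 * (x / √M) * x = p * x ^ 2 := by rw [hp]; ring
  rw [bilin, energyOne]
  rw [← hx] at e3 ⊢
  nlinarith

/-- Boundedness of the form `Q`, given bounds for the drift terms. -/
lemma abs_bilin_le {a c : C(Y, ℝ)} {b b' : E.VectorField} {Ka Kc D D' : ℝ}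
    (ha : ‖a‖ ≤ Ka) (hc : ‖c‖ ≤ Kc)
    (hb : ∀ f, ‖E.mulField (E.toC f) b‖ ≤ D * √(E.energyOne μ f))
    (hb' : ∀ f, ‖E.mulField (E.toC f) b'‖ ≤ D' * √(E.energyOne μ f)) (f g : E.dom) :
    |E.bilin μ a b b' c f g|
      ≤ (Ka + D + D' + Kc) * (√(E.energyOne μ f) * √(E.energyOne μ g)) := by
  have hgrad : ∀ f, ‖E.grad f‖ ≤ √(E.energyOne μ f) := fun f => by
    rw [norm_grad]
    exact Real.sqrt_le_sqrt (le_add_of_nonneg_right (sq_nonneg _))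
  have hL2 : ∀ f, ‖E.toL2 μ f‖ ≤ √(E.energyOne μ f) := fun f =>
    Real.le_sqrt_of_sq_le (le_add_of_nonneg_left (E.nonneg f))
  have hKa : 0 ≤ Ka := (norm_nonneg a).trans ha
  have hKc : 0 ≤ Kc := (norm_nonneg c).trans hc
  have h1 : |inner ℝ (E.mulField a (E.grad f)) (E.grad g)|
      ≤ Ka * √(E.energyOne μ f) * √(E.energyOne μ g) := by
    refine (abs_real_inner_le_norm _ _).trans ?_
    refine mul_le_mul ((E.norm_mulField_le a _).trans ?_) (hgrad g) (norm_nonneg _)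
      (mul_nonneg hKa (Real.sqrt_nonneg _))
    exact mul_le_mul ha (hgrad f) (norm_nonneg _) hKa
  have h2 : |inner ℝ (E.mulField (E.toC g) b) (E.grad f)|
      ≤ D * √(E.energyOne μ g) * √(E.energyOne μ f) :=
    (abs_real_inner_le_norm _ _).trans (mul_le_mul (hb g) (hgrad f) (norm_nonneg _)
      ((norm_nonneg _).trans (hb g)))
  have h3 : |inner ℝ (E.mulField (E.toC f) b') (E.grad g)|
      ≤ D' * √(E.energyOne μ f) * √(E.energyOne μ g) :=
    (abs_real_inner_le_norm _ _).trans (mul_le_mul (hb' f) (hgrad g) (norm_nonneg _)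
      ((norm_nonneg _).trans (hb' f)))
  have h4 : |∫ x, c x * f.1 x * g.1 x ∂μ|
      ≤ Kc * (√(E.energyOne μ f) * √(E.energyOne μ g)) := by
    have e : ∫ x, c x * f.1 x * g.1 x ∂μ
        = inner ℝ (ContinuousMap.toLp 2 μ ℝ (c * E.toC f)) (E.toL2 μ g) := by
      have := ContinuousMap.inner_toLp (𝕜 := ℝ) μ (c * E.toC f) (E.toC g)
      refine Eq.trans (integral_congr_ae (ae_of_all _ fun x => ?_)) this.symm
      simp [mul_comm]
    have hm : ‖ContinuousMap.toLp 2 μ ℝ (c * E.toC f)‖ ≤ Kc * ‖E.toL2 μ f‖ := by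
      refine Lp.norm_le_mul_norm_of_ae_le_mul ?_
      filter_upwards [ContinuousMap.coeFn_toLp (p := 2) (𝕜 := ℝ) μ (c * E.toC f),
        ContinuousMap.coeFn_toLp (p := 2) (𝕜 := ℝ) μ (E.toC f)] with x hx hx'
      change _ ≤ Kc * ‖ContinuousMap.toLp 2 μ ℝ (E.toC f) x‖
      rw [hx, hx', ContinuousMap.mul_apply, norm_mul]
      exact mul_le_mul_of_nonneg_right ((c.norm_coe_le_norm x).trans hc) (norm_nonneg _)
    rw [e]
    refine (abs_real_inner_le_norm _ _).trans ?_
    refine (mul_le_mul (hm.trans (mul_le_mul_of_nonneg_left (hL2 f) hKc)) (hL2 g) (norm_nonneg _)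
      (by positivity)).trans_eq (mul_assoc _ _ _)
  rw [bilin, abs_le]
  rw [abs_le] at h1 h2 h3 h4
  constructor <;> linarith

end Measure

end CompactResistanceForm

/-! ### Smoothing estimate for abstract Cauchy problems. -/

lemma hasDerivAt_shift_quotient {H : Type*} [NormedAddCommGroup H] [NormedSpace ℝ H] {u : ℝ → H}
    (hu : ∀ t > 0, HasDerivAt u (deriv u t) t) {t h : ℝ} (ht : 0 < t) (hh : 0 < h) :
    HasDerivAt (fun r => h⁻¹ • (u (r + h) - u r)) (h⁻¹ • (deriv u (t + h) - deriv u t)) t :=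
  (((hu (t + h) (by linarith)).comp_add_const t h).sub (hu t ht)).const_smul h⁻¹

/-- Difference quotients of a continuously differentiable function converge locally uniformly. -/
lemma exists_quotient_sub_deriv_le {H : Type*} [NormedAddCommGroup H] [NormedSpace ℝ H]
    {u : ℝ → H} (hu : ∀ t > 0, HasDerivAt u (deriv u t) t)
    (hu' : ContinuousOn (deriv u) (Set.Ioi 0)) {s t ε : ℝ} (hs : 0 < s) (hε : 0 < ε) :
    ∃ h₀ > 0, ∀ h, 0 < h → h < h₀ → ∀ r ∈ Set.Icc s t,
      ‖h⁻¹ • (u (r + h) - u r) - deriv u r‖ ≤ ε := by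
  -- The additional unit of length keeps r + h in the interval for all r ≤ t and h < 1.
  have hK : IsCompact (Set.Icc s (t + 1)) := isCompact_Icc
  have huc := hK.uniformContinuousOn_of_continuous
    (hu'.mono fun r hr => lt_of_lt_of_le hs hr.1)
  obtain ⟨d, hd, hd'⟩ := Metric.uniformContinuousOn_iff.1 huc ε hε
  refine ⟨min d 1, lt_min hd one_pos, fun h hh hh' r hr => ?_⟩
  have hd1 : h < d := hh'.trans_le (min_le_left _ _)
  have hh1 : h < 1 := hh'.trans_le (min_le_right _ _)
  -- Mean value inequality for x ↦ u(x) - x u'(r), whose derivative u'(x) - u'(r) is small by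
  -- uniform continuity of u'.
  have key : ‖(u (r + h) - (r + h) • deriv u r) - (u r - r • deriv u r)‖ ≤ ε * (r + h - r) := by
    refine norm_image_sub_le_of_norm_deriv_le_segment'
      (f := fun x => u x - x • deriv u r) (f' := fun x => deriv u x - deriv u r)
      (a := r) (b := r + h) (C := ε) (fun x hx => ?_) (fun x hx => ?_) (r + h)
      (Set.right_mem_Icc.2 (by linarith))
    · have h1 := (hu x (by linarith [hr.1, hx.1])).sub
        ((hasDerivAt_id x).smul_const (deriv u r))
      rw [one_smul] at h1
      exact h1.hasDerivWithinAt
    · have := hd' x ⟨by linarith [hr.1, hx.1], by linarith [hr.2, hx.2]⟩ r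
        ⟨hr.1, by linarith [hr.2]⟩
        (by rw [Real.dist_eq, abs_of_nonneg (by linarith [hx.1])]; linarith [hx.2])
      rw [← dist_eq_norm]; exact this.le
  have e : h⁻¹ • (u (r + h) - u r) - deriv u r
      = h⁻¹ • ((u (r + h) - (r + h) • deriv u r) - (u r - r • deriv u r)) := by
    have : (u (r + h) - (r + h) • deriv u r) - (u r - r • deriv u r)
        = (u (r + h) - u r) - h • deriv u r := by rw [add_smul]; abel
    rw [this, smul_sub h⁻¹ _ (h • _), smul_smul, inv_mul_cancel₀ hh.ne', one_smul]
  rw [e, norm_smul, norm_inv, Real.norm_of_nonneg hh.le, inv_mul_le_iff₀ hh]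
  linarith

section Sectorial

variable {H D : Type*} [NormedAddCommGroup H] [InnerProductSpace ℝ H] [AddCommGroup D] [Module ℝ D]
  {j : D →ₗ[ℝ] H} {Q : D → D → ℝ} {u : ℝ → H} {f : ℝ → D}

/-- Solutions of the Cauchy problem of a nonnegative form are contracted. -/
lemma norm_le_of_cauchy (hQ : ∀ f, 0 ≤ Q f f) (hc : ContinuousOn u (Set.Ici 0))
    (hu : ∀ t > 0, HasDerivAt u (deriv u t) t) (hf : ∀ t > 0, j (f t) = u t)
    (heq : ∀ t > 0, ∀ g, Q (f t) g = - inner ℝ (deriv u t) (j g)) {t : ℝ} (ht : 0 ≤ t) :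
    ‖u t‖ ≤ ‖u 0‖ := by
  -- Testing the equation with the solution gives (‖u‖²)' = 2⟨u, u'⟩ = -2Q(f, f) ≤ 0.
  have hanti : AntitoneOn (fun r => ‖u r‖ ^ 2) (Set.Ici 0) := by
    refine antitoneOn_of_deriv_nonpos (convex_Ici 0) (hc.norm.pow 2) ?_ ?_
    · rw [interior_Ici]
      exact fun r hr => (hu r hr).norm_sq.differentiableAt.differentiableWithinAt
    · rw [interior_Ici]
      intro r hr
      rw [(hu r hr).norm_sq.deriv, ← hf r hr, real_inner_comm]
      linarith [hQ (f r), heq r hr (f r)]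
  have := hanti Set.self_mem_Ici ht ht
  exact abs_le_of_sq_le_sq' this (norm_nonneg _) |>.2

/-- The smoothing estimate `t ‖u'(t)‖ ≤ √K ‖u(0)‖` for solutions of the Cauchy problem of a
sectorial form. -/
lemma norm_deriv_le_of_cauchy {K : ℝ} (hK : 0 ≤ K) (hQ : ∀ f, 0 ≤ Q f f)
    (hsub : ∀ f f' g, Q (f - f') g = Q f g - Q f' g)
    (hsmul : ∀ (r : ℝ) f g, Q (r • f) g = r * Q f g)
    (hsec : ∀ f g, Q f g ^ 2 ≤ K * (Q f f * Q g g))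
    (hc : ContinuousOn u (Set.Ici 0)) (hu : ∀ t > 0, HasDerivAt u (deriv u t) t)
    (hu' : ContinuousOn (deriv u) (Set.Ioi 0)) (hf : ∀ t > 0, j (f t) = u t)
    (heq : ∀ t > 0, ∀ g, Q (f t) g = - inner ℝ (deriv u t) (j g)) {t : ℝ} (ht : 0 < t) :
    t ^ 2 * ‖deriv u t‖ ^ 2 ≤ K * ‖u 0‖ ^ 2 := by
  -- Nothing is known about u' near 0, so the argument starts at a positive time. Half of t makes (t
  -- - s)² = t²/4 cancel the factor K/4 below.
  set s := t / 2 with hs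
  have hs0 : 0 < s := by positivity
  have hst : s ≤ t := by linarith
  obtain ⟨L, hL⟩ : ∃ L, ∀ r ∈ Set.Icc s t, ‖deriv u r‖ ≤ L :=
    isCompact_Icc.exists_bound_of_continuousOn (hu'.mono fun r hr => lt_of_lt_of_le hs0 hr.1)
  have hL0 : 0 ≤ L := (norm_nonneg _).trans (hL t ⟨hst, le_rfl⟩)
  -- the energy inequality for the difference quotients
  have key : ∀ ε, 0 < ε → ∃ h₀ > 0, ∀ h, 0 < h → h < h₀ →
      (t - s) ^ 2 * ‖h⁻¹ • (u (t + h) - u t)‖ ^ 2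
        ≤ K / 4 * ‖u s‖ ^ 2 + 2 * (t - s) * ((L + ε) * ε) * (t - s) := by
    intro ε hε
    obtain ⟨h₀, hh₀, hq⟩ := exists_quotient_sub_deriv_le (t := t) hu hu' hs0 hε
    refine ⟨h₀, hh₀, fun h hh hhh => ?_⟩
    -- As u is only C¹, u' need not be differentiable nor come from the form domain. Its difference
    -- quotients do, and by linearity they solve the same equation.
    set w : ℝ → H := fun r => h⁻¹ • (u (r + h) - u r) with hw
    set z : ℝ → D := fun r => h⁻¹ • (f (r + h) - f r) with hz
    have hder : ∀ r > 0, HasDerivAt w (h⁻¹ • (deriv u (r + h) - deriv u r)) r := fun r hr =>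
      hasDerivAt_shift_quotient hu hr hh
    have hjz : ∀ r > 0, j (z r) = w r := fun r hr => by
      simp only [hz, hw, map_smul, map_sub, hf r hr, hf (r + h) (by linarith)]
    have hQz : ∀ r > 0, ∀ g,
        Q (z r) g = - inner ℝ (h⁻¹ • (deriv u (r + h) - deriv u r)) (j g) := fun r hr g => by
      simp only [hz, hsmul, hsub, heq r hr, heq (r + h) (by linarith), inner_smul_left,
        inner_sub_left, conj_trivial]
      ring
    -- A Lyapunov function. Its derivative contains the bad term 2(r - s)‖w‖² and the dissipation
    -- -2(r - s)²Q(z, z) - (K/2)Q(f, f). The bad term becomes a form value only after replacing ‖w‖²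
    -- by ⟨w, u'⟩ = -Q(f, z); the linear term of F absorbs the error of this replacement.
    set F : ℝ → ℝ := fun r => (r - s) ^ 2 * ‖w r‖ ^ 2 + K / 4 * ‖u r‖ ^ 2
      - 2 * (t - s) * ((L + ε) * ε) * r with hF
    have hFd : ∀ r > 0, HasDerivAt F
        (2 * (r - s) * ‖w r‖ ^ 2
          + (r - s) ^ 2 * (2 * inner ℝ (w r) (h⁻¹ • (deriv u (r + h) - deriv u r)))
          + K / 4 * (2 * inner ℝ (u r) (deriv u r)) - 2 * (t - s) * ((L + ε) * ε)) r := by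
      intro r hr
      have h1 : HasDerivAt (fun r => (r - s) ^ 2) (2 * (r - s)) r := by
        have := ((hasDerivAt_id r).sub_const s).fun_pow 2
        simpa using this
      have h2 := (h1.mul (hder r hr).norm_sq).add ((hu r hr).norm_sq.const_mul (K / 4))
      have h3 := h2.sub ((hasDerivAt_id r).const_mul (2 * (t - s) * ((L + ε) * ε)))
      rw [mul_one] at h3
      exact h3
    have hanti : AntitoneOn F (Set.Icc s t) := by
      refine antitoneOn_of_deriv_nonpos (convex_Icc s t) (fun r hr => ?_) ?_ ?_
      · exact (hFd r (lt_of_lt_of_le hs0 hr.1)).continuousAt.continuousWithinAt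
      · rw [interior_Icc]
        exact fun r hr => (hFd r (hs0.trans hr.1)).differentiableAt.differentiableWithinAt
      · rw [interior_Icc]
        intro r hr
        have hr0 : 0 < r := hs0.trans hr.1
        have hrI : r ∈ Set.Icc s t := ⟨hr.1.le, hr.2.le⟩
        rw [(hFd r hr0).deriv]
        have e1 : inner ℝ (w r) (h⁻¹ • (deriv u (r + h) - deriv u r)) = - Q (z r) (z r) := by
          rw [hQz r hr0, hjz r hr0, real_inner_comm]; ring
        have e2 : inner ℝ (u r) (deriv u r) = - Q (f r) (f r) := by
          rw [heq r hr0, hf r hr0, real_inner_comm]; ring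
        have e3 : inner ℝ (w r) (deriv u r) = - Q (f r) (z r) := by
          rw [heq r hr0, hjz r hr0, real_inner_comm]; ring
        have hrs : 0 ≤ r - s := by linarith [hr.1]
        -- The sector condition followed by the arithmetic-geometric mean inequality; the weight K/4
        -- in F is the one for which the right-hand side matches the dissipation exactly.
        have e4 : 2 * (r - s) * inner ℝ (w r) (deriv u r)
            ≤ K / 2 * Q (f r) (f r) + 2 * (r - s) ^ 2 * Q (z r) (z r) := by
          rw [e3]
          have hn : 0 ≤ K / 2 * Q (f r) (f r) + 2 * (r - s) ^ 2 * Q (z r) (z r) :=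
            add_nonneg (mul_nonneg (by linarith) (hQ _)) (mul_nonneg (by positivity) (hQ _))
          refine abs_le_of_sq_le_sq' ?_ hn |>.2
          have h5 := mul_le_mul_of_nonneg_left (hsec (f r) (z r))
            (by positivity : 0 ≤ 4 * (r - s) ^ 2)
          nlinarith [sq_nonneg (K / 2 * Q (f r) (f r) - 2 * (r - s) ^ 2 * Q (z r) (z r))]
        have hwd : ‖w r - deriv u r‖ ≤ ε := hq h hh hhh r hrI
        have e5 : ‖w r‖ ^ 2 - inner ℝ (w r) (deriv u r) ≤ (L + ε) * ε := by
          rw [← real_inner_self_eq_norm_sq, ← inner_sub_right]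
          refine (real_inner_le_norm _ _).trans (mul_le_mul ?_ hwd (norm_nonneg _) (by linarith))
          have := norm_add_le (deriv u r) (w r - deriv u r)
          rw [add_sub_cancel] at this
          linarith [hL r hrI]
        have e6 : 2 * (r - s) * (‖w r‖ ^ 2 - inner ℝ (w r) (deriv u r))
            ≤ 2 * (t - s) * ((L + ε) * ε) := by
          refine (mul_le_mul_of_nonneg_left e5 (by linarith)).trans ?_
          refine mul_le_mul_of_nonneg_right (by linarith [hr.2]) (by positivity)
        rw [e1, e2]
        nlinarith
    have := hanti (Set.left_mem_Icc.2 hst) (Set.right_mem_Icc.2 hst) hst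
    simp only [hF, sub_self] at this
    have hKu : 0 ≤ K / 4 * ‖u t‖ ^ 2 := by positivity
    nlinarith
  -- First h → 0 with ε fixed, then ε → 0; the bound L for u' does not depend on ε, so the error
  -- disappears.
  have hlim : Tendsto (fun h : ℝ => (t - s) ^ 2 * ‖h⁻¹ • (u (t + h) - u t)‖ ^ 2) (𝓝[>] 0)
      (𝓝 ((t - s) ^ 2 * ‖deriv u t‖ ^ 2)) := by
    have := (hu t ht).tendsto_slope_zero_right
    exact (this.norm.pow 2).const_mul _
  have hle : ∀ ε, 0 < ε → (t - s) ^ 2 * ‖deriv u t‖ ^ 2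
      ≤ K / 4 * ‖u s‖ ^ 2 + 2 * (t - s) * ((L + ε) * ε) * (t - s) := by
    intro ε hε
    obtain ⟨h₀, hh₀, hk⟩ := key ε hε
    refine le_of_tendsto hlim ?_
    filter_upwards [Ioo_mem_nhdsGT hh₀] with h hh
    exact hk h hh.1 hh.2
  have hlim2 : Tendsto (fun ε : ℝ => K / 4 * ‖u s‖ ^ 2 + 2 * (t - s) * ((L + ε) * ε) * (t - s))
      (𝓝[>] 0) (𝓝 (K / 4 * ‖u s‖ ^ 2 + 2 * (t - s) * ((L + 0) * 0) * (t - s))) := by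
    refine Tendsto.mono_left ?_ nhdsWithin_le_nhds
    exact Continuous.tendsto (by fun_prop) 0
  have hfin := ge_of_tendsto hlim2 (eventually_nhdsWithin_of_forall fun ε hε => hle ε hε)
  have hu0 := norm_le_of_cauchy hQ hc hu hf heq hs0.le
  have hu0' : ‖u s‖ ^ 2 ≤ ‖u 0‖ ^ 2 := pow_le_pow_left₀ (norm_nonneg _) hu0 2
  have : t - s = t / 2 := by rw [hs]; ring
  rw [this] at hfin
  nlinarith [mul_le_mul_of_nonneg_left hu0' hK]

end Sectorial

/-! ### Compactness from energy and L² bounds. -/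

namespace CompactResistanceForm

/-- Sequences which are bounded in energy and in `L²` have uniformly convergent subsequences. -/
lemma exists_tendstoUniformly_subseq {X : Type*} [TopologicalSpace X] [CompactSpace X]
    [MeasurableSpace X] [BorelSpace X] [SecondCountableTopology X] (E : CompactResistanceForm X)
    (μ : Measure X) [IsFiniteMeasure μ] [μ.IsOpenPosMeasure] (v : ℕ → E.dom) {C K : ℝ}
    (hC : ∀ n, E.form (v n) (v n) ≤ C) (hK : ∀ n, ‖E.toL2 μ (v n)‖ ≤ K) :
    ∃ j : ℕ → ℕ, StrictMono j ∧ ∃ g : C(X, ℝ),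
      TendstoUniformly (fun i x => (v (j i)).1 x) g atTop := by
  have hC0 : 0 ≤ C := (E.nonneg _).trans (hC 0)
  have hosc : ∀ n x y, (v n).1 x - (v n).1 y ≤ √(E.resistance x y) * √C ∧
      (v n).1 y - (v n).1 x ≤ √(E.resistance x y) * √C := fun n x y => by
    have h1 := (E.abs_sub_le (v n) x y).trans
      (mul_le_mul_of_nonneg_left (Real.sqrt_le_sqrt (hC n)) (Real.sqrt_nonneg _))
    have := abs_le.1 h1
    constructor <;> linarith
  have hunit : ∀ n x, ∀ y ∈ {y | E.resistance x y < 1}, |(v n).1 x - (v n).1 y| ≤ √C := by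
    intro n x y hy
    have h1 : √(E.resistance x y) ≤ 1 := Real.sqrt_le_one.2 (le_of_lt hy)
    have h2 := mul_le_mul_of_nonneg_right h1 (Real.sqrt_nonneg C)
    have := hosc n x y
    rw [abs_le]; constructor <;> linarith
  have hpt : ∀ x, ∃ P : ℝ, ∀ n, |(v n).1 x| ≤ P := by
    intro x
    -- The hypothesis only makes the resistance ball a neighbourhood of its centre; its interior is
    -- open, hence measurable and of positive mass.
    set U := interior {y | E.resistance x y < 1} with hU
    have hxU : x ∈ U := mem_interior_iff_mem_nhds.2 (E.resistance_nhds x one_pos)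
    have hUpos : 0 < μ.real U :=
      ENNReal.toReal_pos (isOpen_interior.measure_pos μ ⟨x, hxU⟩).ne' (measure_ne_top _ _)
    refine ⟨√(2 * C + 2 * K ^ 2 / μ.real U), fun n => ?_⟩
    refine Real.abs_le_sqrt ?_
    have hcont := E.continuous_dom (v n)
    have hint : Integrable (fun y => (v n).1 y ^ 2) μ :=
      Continuous.integrable_of_compactSpace μ (by fun_prop)
    -- Averages v(x)² ≤ 2(v(x) - v(y))² + 2v(y)² over y in U, where the first square is at most C.
    have h1 : ∫ _ in U, ((v n).1 x ^ 2 - 2 * C) / 2 ∂μ ≤ ∫ y in U, (v n).1 y ^ 2 ∂μ := by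
      refine setIntegral_mono_on (integrable_const _) hint.integrableOn
        isOpen_interior.measurableSet fun y hy => ?_
      have h2 := hunit n x y (interior_subset hy)
      have h3 : ((v n).1 x - (v n).1 y) ^ 2 ≤ C := by
        rw [← sq_abs, ← Real.sq_sqrt hC0]
        exact pow_le_pow_left₀ (abs_nonneg _) h2 2
      nlinarith [sq_nonneg ((v n).1 x - 2 * (v n).1 y)]
    have h2 : ∫ y in U, (v n).1 y ^ 2 ∂μ ≤ K ^ 2 := by
      refine (setIntegral_le_integral hint (ae_of_all _ fun y => sq_nonneg _)).trans ?_
      rw [← E.norm_toL2_sq]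
      exact pow_le_pow_left₀ (norm_nonneg _) (hK n) 2
    rw [setIntegral_const, smul_eq_mul] at h1
    have h3 : ((v n).1 x ^ 2 - 2 * C) / 2 ≤ K ^ 2 / μ.real U := by
      rw [le_div_iff₀ hUpos]; linarith
    have : 2 * K ^ 2 / μ.real U = 2 * (K ^ 2 / μ.real U) := by ring
    linarith
  -- Finitely many unit resistance balls cover the space, and on each the oscillation is at most √C.
  obtain ⟨P, hP⟩ : ∃ P : ℝ, ∀ n x, |(v n).1 x| ≤ P := by
    choose P hP using hpt
    obtain ⟨t, -, ht⟩ := isCompact_univ.elim_nhds_subcover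
      (fun x => {y | E.resistance x y < 1}) (fun x _ => E.resistance_nhds x one_pos)
    refine ⟨∑ x ∈ t, |P x| + √C, fun n y => ?_⟩
    obtain ⟨x, hx, hxy⟩ := Set.mem_iUnion₂.1 (ht (Set.mem_univ y))
    have h1 := hunit n x y hxy
    have h2 := (hP x n).trans (le_abs_self _)
    have h3 : |P x| ≤ ∑ x ∈ t, |P x| :=
      Finset.single_le_sum (f := fun x => |P x|) (fun _ _ => abs_nonneg _) hx
    have h4 := abs_sub_abs_le_abs_sub ((v n).1 y) ((v n).1 x)
    rw [abs_sub_comm] at h4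
    linarith
  let F : ℕ → BoundedContinuousFunction X ℝ := fun n =>
    BoundedContinuousFunction.mkOfCompact (E.toC (v n))
  have hequi : Equicontinuous ((↑) : Set.range F → X → ℝ) := by
    intro x
    rw [Metric.equicontinuousAt_iff_right]
    intro ε hε
    filter_upwards [E.resistance_nhds x (r := ε ^ 2 / (C + 1)) (by positivity)] with y hy
    rintro ⟨_, n, rfl⟩
    have hy' : E.resistance x y < ε ^ 2 / (C + 1) := hy
    rw [lt_div_iff₀ (by linarith)] at hy'
    have h1 : |(v n).1 x - (v n).1 y| < ε := by
      refine abs_lt_of_sq_lt_sq ?_ hε.le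
      have h2 := E.sq_sub_le (v n) x y
      nlinarith [E.resistance_nonneg x y, hC n]
    exact h1
  have hcomp := BoundedContinuousFunction.arzela_ascoli (Set.Icc (-P) P) isCompact_Icc
    (Set.range F) (by rintro _ x ⟨n, rfl⟩; exact abs_le.1 (hP n x)) hequi
  obtain ⟨g, -, j, hj, hg⟩ := hcomp.tendsto_subseq (x := F)
    (fun n => subset_closure (Set.mem_range_self n))
  exact ⟨j, hj, g.toContinuousMap, BoundedContinuousFunction.tendsto_iff_tendstoUniformly.1 hg⟩

end CompactResistanceForm

/-! ### Subdivision of cells. -/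

namespace FinitelyRamified

variable {X A : Type*} [TopologicalSpace X] (C : FinitelyRamified X A)

lemma exists_subcell {n m : ℕ} (hnm : n ≤ m) {α : A} (hα : α ∈ C.level n) {z : X}
    (hz : z ∈ C.cell α) : ∃ β ∈ C.level m, z ∈ C.cell β ∧ C.cell β ⊆ C.cell α := by
  induction m, hnm using Nat.le_induction with
  | base => exact ⟨α, hα, hz, subset_rfl⟩
  | succ m _ ih =>
    obtain ⟨β, hβ, hzβ, hβα⟩ := ih
    obtain ⟨s, hs, hu⟩ := C.refine m β hβ
    rw [hu] at hzβ
    obtain ⟨γ, hγ, hzγ⟩ := Set.mem_iUnion₂.1 hzβ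
    refine ⟨γ, hs hγ, hzγ, Set.Subset.trans ?_ hβα⟩
    rw [hu]
    exact Set.subset_biUnion_of_mem (u := fun β => C.cell β) hγ

lemma exists_mem_cell (n : ℕ) (z : X) : ∃ α ∈ C.level n, z ∈ C.cell α := by
  obtain ⟨β, hβ, hz, -⟩ := C.exists_subcell (Nat.zero_le n) (α := C.root)
    (by rw [C.level_zero]; exact Finset.mem_singleton_self _) (z := z)
    (by rw [C.cell_root]; trivial)
  exact ⟨β, hβ, hz⟩

end FinitelyRamified

/-! ### Comparison of X with X^(m) and the uniform pointwise estimate. -/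

namespace ApproxSpaces

variable {X A : Type*} [MetricSpace X] [CompactSpace X] {C : FinitelyRamified X A}
  {S : ApproxSpaces C} {E : CompactResistanceForm X}
  {H : ∀ m, (S.energy m).dom →ₗ[ℝ] (S.energy m).dom}

/-- `ext` is an arbitrary choice off the restrictions of m-harmonic functions; values of `H m` are
such restrictions, so there the chosen inverse has the intended properties. -/
lemma ext_spec (hH : S.IsHarmonicProjection E H) (m : ℕ) (v : (S.energy m).dom) :
    S.ext E m (H m v) ∈ harmonicX C E m ∧
      ∀ x : S.carrier m, (S.ext E m (H m v)).1 x = (H m v).1 x := by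
  have hex : ∃ u ∈ harmonicX C E m,
      (fun (u : E.dom) (x : S.carrier m) => u.1 x) u = (H m v).1 := by
    obtain ⟨u, hu, h⟩ := hH.mem m v
    exact ⟨u, hu, funext fun x => (h x).symm⟩
  exact ⟨Function.invFunOn_mem hex, fun x => congrFun (Function.invFunOn_eq hex) x⟩

/-- Restriction preserves the energy of the m-harmonic extension, and by Pythagoras an orthogonal
projection does not increase energy. -/
lemma form_ext_le [MeasurableSpace X] (hcomp : S.HarmonicCompatible E)
    (hH : S.IsHarmonicProjection E H) (m : ℕ) (v : (S.energy m).dom) :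
    E.form (S.ext E m (H m v)) (S.ext E m (H m v)) ≤ (S.energy m).form v v := by
  obtain ⟨h1, h2⟩ := ext_spec hH m v
  obtain ⟨w, hw, hwe⟩ := hcomp.restrict m _ h1
  have : w = H m v := Subtype.ext (funext fun x => (hw x).trans (h2 x))
  rw [← hwe, this]
  have h3 := hH.orthogonal m v (H m v) (hH.mem m v)
  have h4 := (S.energy m).nonneg (v - H m v)
  have h5 := (S.energy m).form_add (v - H m v) (H m v)
  rw [sub_add_cancel] at h5
  linarith

/-- The deviation of a function from its projection is uniformly small relative to its energy. -/
lemma eventually_norm_sub_le (hdecay : S.ProjectionDecay E H) {ε : ℝ} (hε : 0 < ε) :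
    ∀ᶠ m in atTop, ∀ f : (S.energy m).dom,
      ‖(S.energy m).toC (f - H m f)‖ ≤ ε * √((S.energy m).form f f) := by
  classical
  -- The decay hypothesis concerns sequences. Choosing for each m a violator of energy at most 1,
  -- whenever there is one, and applying it to this sequence rules out violators for all large m;
  -- scaling then treats every energy.
  have hex : ∀ m, ∃ u : (S.energy m).dom, (S.energy m).form u u ≤ 1 ∧
      ∀ f : (S.energy m).dom, (S.energy m).form f f ≤ 1 →
        ε < ‖(S.energy m).toC (f - H m f)‖ → ε < ‖(S.energy m).toC (u - H m u)‖ := by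
    intro m
    by_cases h : ∃ f : (S.energy m).dom, (S.energy m).form f f ≤ 1 ∧
        ε < ‖(S.energy m).toC (f - H m f)‖
    · obtain ⟨u, hu, hu'⟩ := h
      exact ⟨u, hu, fun _ _ _ => hu'⟩
    · exact ⟨0, by simp, fun f hf hf' => absurd ⟨f, hf, hf'⟩ h⟩
  choose u hu hu' using hex
  have hlim := hdecay.sup u ⟨1, by rintro _ ⟨m, rfl⟩; exact hu m⟩
  filter_upwards [hlim.eventually (gt_mem_nhds hε)] with m hm f
  have hunit : ∀ f : (S.energy m).dom, (S.energy m).form f f ≤ 1 →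
      ‖(S.energy m).toC (f - H m f)‖ ≤ ε := fun f hf =>
    not_lt.1 fun h => lt_asymm hm (hu' m f hf h)
  have hscale : ∀ t : ℝ, 0 < t → t ^ 2 * (S.energy m).form f f ≤ 1 →
      t * ‖(S.energy m).toC (f - H m f)‖ ≤ ε := by
    intro t ht h
    have h1 := hunit (t • f) (by
      simp only [map_smul, LinearMap.smul_apply, smul_eq_mul]; linarith)
    rwa [map_smul, ← smul_sub t f, map_smul, norm_smul, Real.norm_of_nonneg ht.le] at h1
  rcases ((S.energy m).nonneg f).eq_or_lt with h0 | h0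
  · rw [← h0, Real.sqrt_zero, mul_zero]
    -- A function of zero energy may be scaled arbitrarily without leaving the unit ball, so its
    -- deviation can be blown up to 2ε unless it vanishes.
    by_contra hn
    rw [not_le] at hn
    have h1 := hscale (2 * ε / ‖(S.energy m).toC (f - H m f)‖) (by positivity)
      (by rw [← h0]; simp)
    rw [div_mul_cancel₀ _ hn.ne'] at h1
    linarith
  · have hs : 0 < √((S.energy m).form f f) := Real.sqrt_pos.2 h0
    have h1 := hscale (1 / √((S.energy m).form f f)) (by positivity)
      (by rw [div_pow, one_pow, Real.sq_sqrt h0.le, one_div_mul_cancel h0.ne'])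
    rwa [one_div_mul_eq_div, div_le_iff₀ hs] at h1

variable [MeasurableSpace X] [BorelSpace X] {μ : Measure X} [IsFiniteMeasure μ]
  {μm : ∀ m, Measure (S.carrier m)} [∀ m, IsFiniteMeasure (μm m)] {V : ℕ → ℝ}
  {Φ : ∀ m, Lp ℝ 2 μ →L[ℝ] Lp ℝ 2 (μm m)}

set_option linter.unusedSectionVars false

/-- Every point of a cell is close to points of the approximating spaces in the same cell. -/
lemma eventually_exists_near (hdiam : Tendsto (fun n => ⨆ α ∈ C.level n, E.rdiam (C.cell α)) atTop
    (𝓝 0)) (hV : S.UniformLowerBound μ μm V) (n : ℕ) {η : ℝ} (hη : 0 < η) :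
    ∀ᶠ m in atTop, ∀ α ∈ C.level n, ∀ z ∈ C.cell α, ∃ y : S.carrier m, (y : X) ∈ C.cell α ∧
      E.resistance z y < η := by
  filter_upwards [eventually_ge_atTop n,
    hdiam.eventually (gt_mem_nhds (ENNReal.ofReal_pos.2 hη))] with m hnm hm α hα z hz
  obtain ⟨β, hβ, hzβ, hβα⟩ := C.exists_subcell hnm hα hz
  -- The vertex set of β is allowed to be empty; it is the positive lower mass bound that provides a
  -- point.
  obtain ⟨y, hy⟩ : (Subtype.val ⁻¹' S.subcell m β : Set (S.carrier m)).Nonempty := by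
    refine nonempty_of_measureReal_ne_zero (μ := μm m) (ne_of_gt ?_)
    exact (hV.pos m).trans_le (hV.le_subcell m β hβ)
  have hyβ : (y : X) ∈ C.cell β := S.subcell_subset m β hβ hy
  refine ⟨y, hβα hyβ, ?_⟩
  refine (ENNReal.ofReal_lt_ofReal_iff hη).1 (lt_of_le_of_lt ?_ hm)
  calc ENNReal.ofReal (E.resistance z y)
      ≤ E.rdiam (C.cell β) := by
        unfold CompactResistanceForm.rdiam
        exact le_iSup₂_of_le z hzβ (le_iSup₂_of_le (y : X) hyβ le_rfl)
    _ ≤ ⨆ α ∈ C.level m, E.rdiam (C.cell α) := le_iSup₂_of_le β hβ le_rfl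

lemma norm_restrictL2_sq (m : ℕ) (w : E.dom) :
    ‖S.restrictL2 E μm m w‖ ^ 2 = ∫ x : S.carrier m, w.1 x ^ 2 ∂(μm m) := by
  rw [← real_inner_self_eq_norm_sq, restrictL2]
  refine (ContinuousMap.inner_toLp (𝕜 := ℝ) (μm m) _ _).trans
    (integral_congr_ae (ae_of_all _ fun x => ?_))
  simp [sq]

/-- Integrals of squares of functions of finite energy converge along the approximating spaces. -/
lemma tendsto_integral_sq (hΦ : S.Connection E μ μm H Φ) (w : E.dom) :
    Tendsto (fun m => ∫ x : S.carrier m, w.1 x ^ 2 ∂(μm m)) atTop (𝓝 (∫ x, w.1 x ^ 2 ∂μ)) := by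
  -- For a constant sequence, Φ_m w and the restriction of w are asymptotically equal in L², and the
  -- norms of Φ_m w converge to that of w.
  have h1 := hΦ.restrict (fun _ => w) (by
    refine ⟨E.form w w, ?_⟩
    rintro _ ⟨m, rfl⟩
    exact le_rfl)
  have h2 := hΦ.tendsto_norm (E.toL2 μ w)
  have h3 : Tendsto (fun m => ‖S.restrictL2 E μm m w‖) atTop (𝓝 ‖E.toL2 μ w‖) := by
    have h4 : Tendsto (fun m => ‖Φ m (E.toL2 μ w)‖ - ‖S.restrictL2 E μm m w‖) atTop (𝓝 0) :=
      squeeze_zero_norm (fun m => by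
        rw [Real.norm_eq_abs]; exact abs_norm_sub_norm_le _ _) h1
    have h5 := h2.sub h4
    simpa using h5
  have h6 := h3.pow 2
  rw [E.norm_toL2_sq] at h6
  exact h6.congr fun m => norm_restrictL2_sq m w

/-- The neighborhoods of a cell have asymptotically at least the mass of the cell. -/
lemma exists_cutoff_mass (hV : S.UniformLowerBound μ μm V) (hΦ : S.Connection E μ μm H Φ) {n : ℕ}
    {α : A} (hα : α ∈ C.level n) {η : ℝ} (hη : 0 < η) :
    ∃ w : E.dom, (∀ x, 0 ≤ w.1 x ∧ w.1 x ≤ 1) ∧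
      (∀ y, w.1 y ≠ 0 → ∃ z ∈ C.cell α, E.resistance z y < η) ∧
      ∀ᶠ m in atTop, V n / 2 < ∫ x : S.carrier m, w.1 x ^ 2 ∂(μm m) := by
  have hcl := (C.isCompact_cell α).isClosed
  obtain ⟨w, hw, hw1, hw0⟩ := E.exists_cutoff (s := C.cell α)
    (U := ⋃ z ∈ C.cell α, interior {y | E.resistance z y < η}) hcl
    (isOpen_biUnion fun _ _ => isOpen_interior)
    (fun z hz => Set.mem_biUnion hz (mem_interior_iff_mem_nhds.2 (E.resistance_nhds z hη)))
  refine ⟨w, hw, fun y hy => ?_, ?_⟩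
  · obtain ⟨z, hz, hzy⟩ := Set.mem_iUnion₂.1 (not_imp_comm.1 (hw0 y) hy)
    have hzy' : y ∈ {y | E.resistance z y < η} := interior_subset hzy
    exact ⟨z, hz, hzy'⟩
  -- In the limit the integral is at least μ(X_α) ≥ V n, so half of V n is eventually exceeded. The
  -- lower bound for μ^(m) would only give V m, which may tend to 0.
  · refine (tendsto_integral_sq hΦ w).eventually (lt_mem_nhds ?_)
    have hc := E.continuous_dom w
    have hint : Integrable (fun x => w.1 x ^ 2) μ :=
      Continuous.integrable_of_compactSpace μ (by fun_prop)
    have h1 : μ.real (C.cell α) ≤ ∫ x, w.1 x ^ 2 ∂μ := by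
      refine le_trans (le_of_eq ?_)
        (setIntegral_le_integral (s := C.cell α) hint (ae_of_all _ fun x => sq_nonneg _))
      rw [setIntegral_congr_fun (g := fun _ => (1 : ℝ)) hcl.measurableSet
        (fun x hx => by simp [hw1 x hx]), setIntegral_const, smul_eq_mul, mul_one]
    linarith [hV.le_cell n α hα, hV.pos n]

/-- A pointwise bound by the energy and the `L²`-norm on the approximating spaces. -/
lemma eventually_sq_le (hdiam : Tendsto (fun n => ⨆ α ∈ C.level n, E.rdiam (C.cell α)) atTop
    (𝓝 0)) (hcomp : S.HarmonicCompatible E) (hH : S.IsHarmonicProjection E H)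
    (hdecay : S.ProjectionDecay E H) (hV : S.UniformLowerBound μ μm V)
    (hΦ : S.Connection E μ μm H Φ) {M B : ℝ} (hM : 0 < M) (hB : 0 < B) {n : ℕ}
    (hn : S.Admissible M B n) :
    ∀ᶠ m in atTop, ∀ (f : (S.energy m).dom) (x : S.carrier m),
      f.1 x ^ 2 ≤ (S.energy m).form f f / (M * B)
        + 4 / V n * ‖(S.energy m).toL2 (μm m) f‖ ^ 2 := by
  -- By admissibility, r√E^(m)(f) bounds the oscillation of f over the part of a generation-n cell
  -- in X^(m). All other errors are made at most r/20 times the same root.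
  set r := √(1 / (4 * (M * B))) with hr
  have hMB : 0 < M * B := mul_pos hM hB
  have hr0 : 0 < r := Real.sqrt_pos.2 (by positivity)
  have hr2 : r ^ 2 = 1 / (4 * (M * B)) := Real.sq_sqrt (by positivity)
  have hη : 0 < (r / 20) ^ 2 := by positivity
  have hcut : ∀ᶠ m in atTop, ∀ α ∈ C.level n, ∃ w : E.dom, (∀ x, 0 ≤ w.1 x ∧ w.1 x ≤ 1) ∧
      (∀ y, w.1 y ≠ 0 → ∃ z ∈ C.cell α, E.resistance z y < (r / 20) ^ 2) ∧
      V n / 2 < ∫ x : S.carrier m, w.1 x ^ 2 ∂(μm m) := by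
    rw [Filter.eventually_all_finset]
    intro α hα
    obtain ⟨w, h1, h2, h3⟩ := exists_cutoff_mass hV hΦ hα hη
    exact h3.mono fun m hm => ⟨w, h1, h2, hm⟩
  filter_upwards [hcut, eventually_exists_near hdiam hV n hη, eventually_ge_atTop n,
    eventually_norm_sub_le hdecay (ε := r / 20) (by positivity)] with m hm hnear hmn hdev f x
  obtain ⟨α, hα, hxα⟩ := C.exists_mem_cell n (x : X)
  obtain ⟨w, hw, hwU, hmass⟩ := hm α hα
  set e := (S.energy m).form f f with he
  have he0 : 0 ≤ e := (S.energy m).nonneg f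
  -- The support of w sticks out of the cell, and nearby points of X_α may lie outside X^(m). There
  -- h replaces f: it is defined on all of X, has no more energy than f, and is uniformly close to f
  -- on X^(m).
  set h := S.ext E m (H m f) with hh
  have hfh : ∀ y : S.carrier m, |f.1 y - h.1 y| ≤ r / 20 * √e := fun y => by
    rw [(ext_spec hH m f).2 y]
    exact ((S.energy m).abs_le_norm (f - H m f) y).trans (hdev f)
  have hhosc : ∀ y z, E.resistance y z < (r / 20) ^ 2 → |h.1 y - h.1 z| ≤ r / 20 * √e := by
    intro y z hyz
    refine (E.abs_sub_le h y z).trans ?_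
    refine mul_le_mul ?_ (Real.sqrt_le_sqrt (form_ext_le hcomp hH m f)) (Real.sqrt_nonneg _)
      (by positivity)
    exact (Real.sqrt_le_left (by positivity)).2 hyz.le
  have hfosc : ∀ y : S.carrier m, (y : X) ∈ C.cell α → |f.1 x - f.1 y| ≤ r * √e := by
    intro y hy
    have h1 : (S.energy m).resistance x y * (4 * M * B) ≤ 1 := by
      have h2 := hn m hmn α hα
      have h3 : ENNReal.ofReal ((S.energy m).resistance x y)
          ≤ (S.energy m).rdiam (Subtype.val ⁻¹' C.cell α) := by
        unfold CompactResistanceForm.rdiam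
        exact le_iSup₂_of_le x hxα (le_iSup₂_of_le y hy le_rfl)
      have h4 := (mul_le_mul_left h3 (ENNReal.ofReal (4 * M * B))).trans h2
      rw [← ENNReal.ofReal_mul ((S.energy m).resistance_nonneg x y), ENNReal.ofReal_le_one] at h4
      exact h4
    refine ((S.energy m).abs_sub_le f x y).trans
      (mul_le_mul_of_nonneg_right (Real.sqrt_le_sqrt ?_) (Real.sqrt_nonneg _))
    rw [le_div_iff₀ (by positivity)]
    linarith
  -- The path is f(x), f(z'), h(z'), h(z), h(y), f(y), with steps r and four times r/20, in all
  -- (6/5)r√e. As 2·(36/25)·(1/4) < 1, the energy term stays below e/(MB).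
  have hpt : ∀ y : S.carrier m, w.1 y ≠ 0 → f.1 x ^ 2 ≤ e / (M * B) + 2 * f.1 y ^ 2 := by
    intro y hy
    obtain ⟨z, hz, hzy⟩ := hwU y hy
    obtain ⟨z', hz', hzz'⟩ := hnear α hα z hz
    have a1 := abs_le.1 (hfosc z' hz')
    have a2 := abs_le.1 (hfh z')
    have a3 := abs_le.1 (hhosc z z' hzz')
    have a4 := abs_le.1 (hhosc z y hzy)
    have a5 := abs_le.1 (hfh y)
    have a6 : |f.1 x - f.1 y| ≤ 6 / 5 * r * √e := by
      rw [abs_le]; constructor <;> linarith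
    have a7 : (f.1 x - f.1 y) ^ 2 ≤ (6 / 5 * r * √e) ^ 2 := by
      rw [← sq_abs]; exact pow_le_pow_left₀ (abs_nonneg _) a6 2
    have a8 : (6 / 5 * r * √e) ^ 2 = 36 / 25 * (1 / (4 * (M * B))) * e := by
      rw [mul_pow, mul_pow, hr2, Real.sq_sqrt he0]; ring
    have a9 : e / (M * B) = 4 * (1 / (4 * (M * B))) * e := by field_simp
    have a10 : 0 ≤ 1 / (4 * (M * B)) * e := by positivity
    nlinarith [sq_nonneg (f.1 x - 2 * f.1 y)]
  set I := ∫ x : S.carrier m, w.1 x ^ 2 ∂(μm m) with hI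
  have hIpos : 0 < I := by linarith [hV.pos n]
  have hwc : Continuous fun y : S.carrier m => w.1 y :=
    (E.continuous_dom w).comp continuous_subtype_val
  have hw2 : ∀ k : ℝ, Continuous fun y : S.carrier m => k * w.1 y ^ 2 := fun k =>
    continuous_const.mul (hwc.pow 2)
  have hf2 : Continuous fun y : S.carrier m => 2 * f.1 y ^ 2 :=
    continuous_const.mul (((S.energy m).continuous_dom f).pow 2)
  -- Averaging with the weight w² ≤ 1 turns the values f(y)² into the L² norm; dividing by I > V n /
  -- 2 produces the constant 4 / V n.
  have hint : f.1 x ^ 2 * I ≤ e / (M * B) * I + 2 * ‖(S.energy m).toL2 (μm m) f‖ ^ 2 := by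
    rw [CompactResistanceForm.norm_toL2_sq, hI, ← integral_const_mul, ← integral_const_mul,
      ← integral_const_mul,
      ← integral_add (Continuous.integrable_of_compactSpace _ (hw2 _)) (Continuous.integrable_of_compactSpace _ hf2)]
    refine integral_mono (Continuous.integrable_of_compactSpace _ (hw2 _))
      (Continuous.integrable_of_compactSpace _ ((hw2 _).add hf2)) fun y => ?_
    simp only
    by_cases hy : w.1 y = 0
    · rw [hy]; nlinarith [sq_nonneg (f.1 y)]
    · have h1 : w.1 y ^ 2 ≤ 1 := pow_le_one₀ (hw y).1 (hw y).2
      nlinarith [mul_le_mul_of_nonneg_right (hpt y hy) (sq_nonneg (w.1 y)), sq_nonneg (f.1 y),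
        mul_le_mul_of_nonneg_left h1 (sq_nonneg (f.1 y))]
  have hVn := hV.pos n
  have hfin : (f.1 x ^ 2 - e / (M * B)) * I ≤ 4 / V n * ‖(S.energy m).toL2 (μm m) f‖ ^ 2 * I := by
    have h1 : 2 ≤ 4 / V n * I := by
      rw [div_mul_eq_mul_div, le_div_iff₀ hVn]; linarith
    nlinarith [mul_le_mul_of_nonneg_right h1 (sq_nonneg ‖(S.energy m).toL2 (μm m) f‖)]
  linarith [le_of_mul_le_mul_right hfin hIpos]

end ApproxSpaces

/-! ### Uniform form bounds and compactness along the sequence. -/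

namespace ApproxSpaces

variable {X A : Type*} [MetricSpace X] [CompactSpace X] {C : FinitelyRamified X A}
  {S : ApproxSpaces C} {E : CompactResistanceForm X}
  {H : ∀ m, (S.energy m).dom →ₗ[ℝ] (S.energy m).dom}

set_option linter.unusedSectionVars false

lemma gammaConst_nonneg {V : ℕ → ℝ} {n : ℕ} (hV : 0 < V n) (b : ∀ m, (S.energy m).VectorField) :
    0 ≤ S.gammaConst V b n :=
  mul_nonneg (by positivity) (Real.iSup_nonneg fun _ => sq_nonneg _)

variable [MeasurableSpace X] [BorelSpace X] {μ : Measure X} [IsFiniteMeasure μ]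
  {μm : ∀ m, Measure (S.carrier m)} [∀ m, IsFiniteMeasure (μm m)] {V : ℕ → ℝ}
  {Φ : ∀ m, Lp ℝ 2 μ →L[ℝ] Lp ℝ 2 (μm m)}

/-- The drift vector fields are form bounded, with constants `1 / M` and `2 γ_M`. -/
lemma eventually_norm_mulField_sq_le
    (hdiam : Tendsto (fun n => ⨆ α ∈ C.level n, E.rdiam (C.cell α)) atTop (𝓝 0))
    (hcomp : S.HarmonicCompatible E) (hH : S.IsHarmonicProjection E H)
    (hdecay : S.ProjectionDecay E H) (hV : S.UniformLowerBound μ μm V)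
    (hΦ : S.Connection E μ μm H Φ) {M : ℝ} (hM : 0 < M) {b : ∀ m, (S.energy m).VectorField}
    (hb : BddAbove (Set.range fun m => ‖b m‖ ^ 2)) {n : ℕ}
    (hn : S.Admissible M (⨆ m, ‖b m‖ ^ 2) n) :
    ∀ᶠ m in atTop, ∀ f : (S.energy m).dom,
      ‖(S.energy m).mulField ((S.energy m).toC f) (b m)‖ ^ 2 ≤ (S.energy m).form f f / M
        + 2 * S.gammaConst V b n * ‖(S.energy m).toL2 (μm m) f‖ ^ 2 := by
  have hle : ∀ m, ‖b m‖ ^ 2 ≤ ⨆ m, ‖b m‖ ^ 2 := fun m => le_ciSup hb m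
  have hγ := gammaConst_nonneg (hV.pos n) b
  have hmul : ∀ m (f : (S.energy m).dom),
      ‖(S.energy m).mulField ((S.energy m).toC f) (b m)‖ ^ 2
        ≤ ‖(S.energy m).toC f‖ ^ 2 * ‖b m‖ ^ 2 := fun m f => by
    rw [← mul_pow]
    exact pow_le_pow_left₀ (norm_nonneg _) ((S.energy m).norm_mulField_le _ _) 2
  have hB0 : 0 ≤ ⨆ m, ‖b m‖ ^ 2 := Real.iSup_nonneg fun _ => sq_nonneg _
  -- If the supremum is zero, all drifts vanish and there is nothing to bound; the pointwise
  -- estimate divides by it.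
  rcases hB0.eq_or_lt with hB | hB
  · refine Eventually.of_forall fun m f => (hmul m f).trans ?_
    have h0 : ‖b m‖ ^ 2 = 0 := le_antisymm ((hle m).trans hB.symm.le) (sq_nonneg _)
    rw [h0, mul_zero]
    have := (S.energy m).nonneg f
    positivity
  · filter_upwards [eventually_sq_le hdiam hcomp hH hdecay hV hΦ hM hB hn,
      eventually_ge_atTop n] with m hm hmn f
    have hVn := hV.pos n
    have he := (S.energy m).nonneg f
    set T := (S.energy m).form f f / (M * ⨆ m, ‖b m‖ ^ 2)
      + 4 / V n * ‖(S.energy m).toL2 (μm m) f‖ ^ 2 with hT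
    have hT0 : 0 ≤ T := by positivity
    have hnorm : ‖(S.energy m).toC f‖ ^ 2 ≤ T := by
      rw [← Real.sq_sqrt hT0]
      refine pow_le_pow_left₀ (norm_nonneg _) ?_ 2
      rw [ContinuousMap.norm_le _ (Real.sqrt_nonneg _)]
      exact fun x => Real.abs_le_sqrt (hm f x)
    refine (hmul m f).trans ((mul_le_mul_of_nonneg_right hnorm (sq_nonneg _)).trans ?_)
    rw [hT, add_mul]
    have h1 : ‖b m‖ ^ 2 ≤ ⨆ m : {m // n ≤ m}, ‖b m‖ ^ 2 :=
      le_ciSup (f := fun m : {m // n ≤ m} => ‖b m‖ ^ 2)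
        (hb.mono (by rintro _ ⟨m, rfl⟩; exact ⟨m, rfl⟩)) ⟨m, hmn⟩
    refine add_le_add ?_ ?_
    · calc _ ≤ (S.energy m).form f f / (M * ⨆ m, ‖b m‖ ^ 2) * ⨆ m, ‖b m‖ ^ 2 :=
            mul_le_mul_of_nonneg_left (hle m) (by positivity)
        _ = _ := by field_simp
    -- The factor 4 / V n from the pointwise bound is twice the factor in γ_M, whence 2γ_M. The
    -- supremum over m ≥ n suffices because only such m occur here.
    · rw [gammaConst]
      calc _ ≤ 4 / V n * ‖(S.energy m).toL2 (μm m) f‖ ^ 2 * ⨆ m : {m // n ≤ m}, ‖b m‖ ^ 2 :=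
            mul_le_mul_of_nonneg_left h1 (by positivity)
        _ = _ := by ring

/-- Uniform coercivity and uniform boundedness of the forms `Q` on the approximating spaces. -/
lemma exists_uniform_bilin [μ.IsOpenPosMeasure]
    (hdiam : Tendsto (fun n => ⨆ α ∈ C.level n, E.rdiam (C.cell α)) atTop (𝓝 0))
    (hcomp : S.HarmonicCompatible E) (hH : S.IsHarmonicProjection E H)
    (hdecay : S.ProjectionDecay E H) (hV : S.UniformLowerBound μ μm V)
    (hΦ : S.Connection E μ μm H Φ) {a c : C(X, ℝ)} {lam M : ℝ} (ha : ∀ x, lam ≤ a x)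
    (hM : 0 < M) (hlam : 0 < lam / 2 - 1 / √M) {b b' : ∀ m, (S.energy m).VectorField}
    (hb : BddAbove (Set.range fun m => ‖b m‖ ^ 2))
    (hb' : BddAbove (Set.range fun m => ‖b' m‖ ^ 2)) {n n' : ℕ}
    (hn : S.Admissible M (⨆ m, ‖b m‖ ^ 2) n) (hn' : S.Admissible M (⨆ m, ‖b' m‖ ^ 2) n')
    (hc : 0 < essInf (fun x => - c x) μ
      - (S.gammaConst V b n + S.gammaConst V b' n') / (lam - 2 / √M)) :
    ∃ δ > 0, ∃ K : ℝ, ∀ᶠ m in atTop,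
      (∀ f, δ * (S.energy m).energyOne (μm m) f ≤ (S.energy m).bilin (μm m)
        (a.restrict (S.carrier m)) (b m) (b' m) (c.restrict (S.carrier m)) f f) ∧
      ∀ f g, |(S.energy m).bilin (μm m)
        (a.restrict (S.carrier m)) (b m) (b' m) (c.restrict (S.carrier m)) f g|
        ≤ K * (√((S.energy m).energyOne (μm m) f) * √((S.energy m).energyOne (μm m) g)) := by
  set G := S.gammaConst V b n
  set G' := S.gammaConst V b' n'
  have hG : 0 ≤ G := gammaConst_nonneg (hV.pos n) b
  have hG' : 0 ≤ G' := gammaConst_nonneg (hV.pos n') b'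
  set p := lam - 2 / √M with hp
  have hp0 : 0 < p := by
    have : 2 / √M = 2 * (1 / √M) := by ring
    rw [hp]; linarith
  set c₀ := essInf (fun x => - c x) μ with hc₀
  have hGp : 0 ≤ (G + G') / p := by positivity
  have hc₀pos : 0 < c₀ := by linarith
  have hgap : 0 < c₀ * p - (G + G') := by
    have := mul_pos hc hp0
    rwa [sub_mul, div_mul_cancel₀ _ hp0.ne'] at this
  -- The essential bound must hold at every point, since c is to be restricted to X^(m), which may
  -- be a μ-null set. It does because a closed set of full measure is everything when μ charges all
  -- nonempty open sets.
  have hcle : ∀ x, c₀ ≤ - c x := by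
    have hclosed : IsClosed {x | c₀ ≤ - c x} :=
      isClosed_le continuous_const c.continuous.neg
    have hae : ∀ᵐ x ∂μ, c₀ ≤ - c x := ae_essInf_le (by
      refine isBoundedUnder_of ⟨-‖c‖, fun x => ?_⟩
      have := (abs_le.1 (c.norm_coe_le_norm x)).2
      exact neg_le_neg this)
    have huniv := (hclosed.ae_eq_univ_iff_eq (μ := μ)).1 (eventuallyEq_univ.2 hae)
    exact fun x => huniv.ge (Set.mem_univ x)
  set D := 1 / M + 2 * G
  set D' := 1 / M + 2 * G'
  refine ⟨(c₀ * p - (G + G')) / (p + c₀), by positivity, ‖a‖ + √D + √D' + ‖c‖, ?_⟩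
  filter_upwards [eventually_norm_mulField_sq_le hdiam hcomp hH hdecay hV hΦ hM hb hn,
    eventually_norm_mulField_sq_le hdiam hcomp hH hdecay hV hΦ hM hb' hn'] with m hm hm'
  have hdrift : ∀ {v : (S.energy m).VectorField} {g : ℝ}, 0 ≤ g →
      (∀ f, ‖(S.energy m).mulField ((S.energy m).toC f) v‖ ^ 2 ≤ (S.energy m).form f f / M
        + 2 * g * ‖(S.energy m).toL2 (μm m) f‖ ^ 2) →
      ∀ f, ‖(S.energy m).mulField ((S.energy m).toC f) v‖
        ≤ √(1 / M + 2 * g) * √((S.energy m).energyOne (μm m) f) := by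
    intro v g hg hv f
    rw [← Real.sqrt_mul (by positivity)]
    refine Real.le_sqrt_of_sq_le ((hv f).trans ?_)
    rw [CompactResistanceForm.energyOne]
    have h1 := (S.energy m).nonneg f
    have h2 : 0 ≤ 2 * g * (S.energy m).form f f := by positivity
    have h3 : 0 ≤ 1 / M * ‖(S.energy m).toL2 (μm m) f‖ ^ 2 := by positivity
    have h4 : (S.energy m).form f f / M = 1 / M * (S.energy m).form f f := by ring
    linarith
  have hrestr : ∀ g : C(X, ℝ), ‖g.restrict (S.carrier m)‖ ≤ ‖g‖ := fun g =>
    (ContinuousMap.norm_le _ (norm_nonneg _)).2 fun x => g.norm_coe_le_norm x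
  refine ⟨fun f => ?_, fun f g => ?_⟩
  · exact (S.energy m).coercive_bilin (μm m) hM hp0 (fun x => ha x) (fun x => hcle x) hG hG'
      hc₀pos (hm f) (hm' f)
  · exact (S.energy m).abs_bilin_le (μm m) (hrestr a) (hrestr c) (hdrift hG hm) (hdrift hG' hm')
      f g

/-- Extensions of projections of functions with bounded energies on the approximating spaces have
uniformly convergent subsequences. -/
lemma exists_tendstoUniformly_ext [μ.IsOpenPosMeasure] (hcomp : S.HarmonicCompatible E)
    (hH : S.IsHarmonicProjection E H) (hΦ : S.Connection E μ μm H Φ)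
    (u : ∀ m, (S.energy m).dom) {K : ℝ}
    (hu : ∀ᶠ m in atTop, (S.energy m).energyOne (μm m) (u m) ≤ K) {k : ℕ → ℕ}
    (hk : StrictMono k) :
    ∃ j : ℕ → ℕ, StrictMono j ∧ ∃ v : C(X, ℝ),
      TendstoUniformly (fun i x => (S.ext E (k (j i)) (H (k (j i)) (u (k (j i))))).1 x) v
        atTop := by
  classical
  -- The `extension` hypothesis asks for a bound at every m, whereas the given one holds eventually.
  -- The finitely many exceptions are set to 0, which does not affect the limit.
  set u' : ∀ m, (S.energy m).dom := fun m =>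
    if (S.energy m).energyOne (μm m) (u m) ≤ K then u m else 0 with hu'
  have hzero : ∀ m, (S.energy m).energyOne (μm m) 0 = 0 := fun m => by
    simp [CompactResistanceForm.energyOne]
  have hbdd : ∀ m, (S.energy m).energyOne (μm m) (u' m) ≤ max K 0 := by
    intro m
    by_cases h : (S.energy m).energyOne (μm m) (u m) ≤ K
    · simp only [hu', if_pos h]; exact h.trans (le_max_left _ _)
    · simp only [hu', if_neg h, hzero]; exact le_max_right _ _
  obtain ⟨P, hP⟩ := hΦ.extension u' ⟨max K 0, by rintro _ ⟨m, rfl⟩; exact hbdd m⟩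
  obtain ⟨j, hj, v, hv⟩ := E.exists_tendstoUniformly_subseq μ
    (fun i => S.ext E (k i) (H (k i) (u' (k i)))) (C := max K 0) (K := P)
    (fun i => (form_ext_le hcomp hH _ _).trans
      ((le_add_of_nonneg_right (sq_nonneg _)).trans (hbdd (k i))))
    (fun i => hP ⟨k i, rfl⟩)
  refine ⟨j, hj, v, fun U hU => ?_⟩
  filter_upwards [hv U hU, (hk.tendsto_atTop.comp hj.tendsto_atTop).eventually hu] with i hvi hi x
  have hi' : u' (k (j i)) = u (k (j i)) := if_pos hi
  simpa only [hi'] using hvi x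

end ApproxSpaces

/-! ### A priori bounds for elliptic and parabolic solutions. -/

namespace CompactResistanceForm

variable {Y : Type*} [TopologicalSpace Y] [CompactSpace Y] [MeasurableSpace Y] [BorelSpace Y]
  [SecondCountableTopology Y] (E : CompactResistanceForm Y) (μ : Measure Y) [IsFiniteMeasure μ]
  {a c : C(Y, ℝ)} {b b' : E.VectorField} {δ K : ℝ}

set_option linter.unusedSectionVars false

/-- The energy of a weak solution is bounded by the right hand side. -/
lemma energyOne_le_of_isWeakSolution (hδ : 0 < δ)
    (hcoer : ∀ f, δ * E.energyOne μ f ≤ E.bilin μ a b b' c f f) {f : Lp ℝ 2 μ} {u : E.dom}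
    (hu : E.bilin μ a b b' c u u = - inner ℝ f (E.toL2 μ u)) :
    E.energyOne μ u ≤ ‖f‖ ^ 2 / δ ^ 2 := by
  -- Only the equation tested with the solution enters; one factor √E_1(u) cancels between
  -- coercivity and the Cauchy–Schwarz bound of the right-hand side.
  have h1 := hcoer u
  rw [hu] at h1
  have h2 := (neg_le_abs _).trans (abs_real_inner_le_norm f (E.toL2 μ u))
  have h3 : ‖E.toL2 μ u‖ ≤ √(E.energyOne μ u) :=
    Real.le_sqrt_of_sq_le (le_add_of_nonneg_left (E.nonneg u))
  set s := √(E.energyOne μ u)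
  have hs : s ^ 2 = E.energyOne μ u := Real.sq_sqrt (E.energyOne_nonneg μ u)
  have h4 : δ * s * s ≤ ‖f‖ * s := by
    have := mul_le_mul_of_nonneg_left h3 (norm_nonneg f)
    nlinarith
  have h5 : δ * s ≤ ‖f‖ := by
    rcases (Real.sqrt_nonneg (E.energyOne μ u)).eq_or_lt with h | h
    · change 0 = s at h
      rw [← h, mul_zero]; exact norm_nonneg f
    · exact le_of_mul_le_mul_right h4 h
  rw [← hs, le_div_iff₀ (by positivity)]
  have h6 : 0 ≤ δ * s := mul_nonneg hδ.le (Real.sqrt_nonneg _)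
  nlinarith

/-- The energy of the solution of the Cauchy problem at a positive time is bounded by the initial
value. -/
lemma energyOne_rep_le_of_isCauchySolution [μ.IsOpenPosMeasure] (hδ : 0 < δ)
    (hcoer : ∀ f, δ * E.energyOne μ f ≤ E.bilin μ a b b' c f f)
    (hbdd : ∀ f g, |E.bilin μ a b b' c f g| ≤ K * (√(E.energyOne μ f) * √(E.energyOne μ g)))
    {u₀ : Lp ℝ 2 μ} {u : ℝ → Lp ℝ 2 μ} (hu : E.IsCauchySolution μ a b b' c u₀ u) {t : ℝ}
    (ht : 0 < t) :
    E.energyOne μ (E.rep μ (u t)) ≤ (K / δ) ^ 2 * ‖u₀‖ ^ 2 / t ^ 2 / δ ^ 2 := by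
  -- Finite-energy representatives are chosen for all times at once, with the irrelevant value 0 for
  -- t ≤ 0.
  have hex : ∀ t, ∃ f : E.dom, 0 < t → E.toL2 μ f = u t ∧
      ∀ g : E.dom, E.bilin μ a b b' c f g = - inner ℝ (deriv u t) (E.toL2 μ g) := by
    intro t
    by_cases h : 0 < t
    · obtain ⟨f, hf⟩ := hu.eq t h
      exact ⟨f, fun _ => hf⟩
    · exact ⟨0, fun h' => absurd h' h⟩
  choose f hf using hex
  have hnn : ∀ f, 0 ≤ E.bilin μ a b b' c f f := fun f =>
    (mul_nonneg hδ.le (E.energyOne_nonneg μ f)).trans (hcoer f)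
  -- Boundedness by K and coercivity by δ give the sector condition with constant (K/δ)², the one in
  -- the smoothing estimate.
  have hsec : ∀ f g, E.bilin μ a b b' c f g ^ 2
      ≤ (K / δ) ^ 2 * (E.bilin μ a b b' c f f * E.bilin μ a b b' c g g) := by
    intro f g
    have hf0 := E.energyOne_nonneg μ f
    have hg0 := E.energyOne_nonneg μ g
    have h1 : E.bilin μ a b b' c f g ^ 2 ≤ K ^ 2 * (E.energyOne μ f * E.energyOne μ g) := by
      rw [← sq_abs]
      refine (pow_le_pow_left₀ (abs_nonneg _) (hbdd f g) 2).trans_eq ?_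
      rw [mul_pow, mul_pow, Real.sq_sqrt hf0, Real.sq_sqrt hg0]
    have h2 := mul_le_mul (hcoer f) (hcoer g) (mul_nonneg hδ.le hg0) (hnn f)
    refine h1.trans ?_
    calc K ^ 2 * (E.energyOne μ f * E.energyOne μ g)
        = (K / δ) ^ 2 * (δ * E.energyOne μ f * (δ * E.energyOne μ g)) := by field_simp
      _ ≤ _ := mul_le_mul_of_nonneg_left h2 (sq_nonneg _)
  have hder : ∀ t > 0, HasDerivAt u (deriv u t) t := fun t ht =>
    ((hu.contDiffOn.differentiableOn one_ne_zero).differentiableAt (Ioi_mem_nhds ht)).hasDerivAt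
  have hbound := norm_deriv_le_of_cauchy (j := E.toL2 μ) (Q := E.bilin μ a b b' c) (u := u)
    (f := f) (sq_nonneg (K / δ)) hnn (E.bilin_sub_left μ a b b' c) (E.bilin_smul_left μ a b b' c)
    hsec hu.continuousOn hder (hu.contDiffOn.continuousOn_deriv_of_isOpen isOpen_Ioi le_rfl)
    (fun t ht => (hf t ht).1) (fun t ht => (hf t ht).2) ht
  -- The chosen representative is the only one, as `toL2` is injective. At the fixed time t it
  -- solves the elliptic equation with right-hand side u'(t).
  rw [← (hf t ht).1, rep_toL2]
  refine (E.energyOne_le_of_isWeakSolution μ hδ hcoer ((hf t ht).2 (f t))).trans ?_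
  refine div_le_div_of_nonneg_right ?_ (by positivity)
  rw [le_div_iff₀ (by positivity), ← hu.init, mul_comm]
  exact hbound

end CompactResistanceForm

/-! ### Subsequential uniform convergence of solutions. -/

theorem corollary5p11 {X A : Type*} [MetricSpace X] [CompactSpace X] [MeasurableSpace X]
    [BorelSpace X] [Countable A] (C : FinitelyRamified X A)
    -- the resistance form on `X`
    (E : CompactResistanceForm X) (hdense : Dense (⋃ n, C.vertices n))
    (hdiam : Tendsto (fun n => ⨆ α ∈ C.level n, E.rdiam (C.cell α)) atTop (𝓝 0))
    -- the approximating spaces and the projections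
    (S : ApproxSpaces C) (hcomp : S.HarmonicCompatible E)
    (H : ∀ m, (S.energy m).dom →ₗ[ℝ] (S.energy m).dom) (hH : S.IsHarmonicProjection E H)
    (hdecay : S.ProjectionDecay E H)
    -- the measures and the identification operators
    (μ : Measure X) [IsFiniteMeasure μ] [μ.IsOpenPosMeasure]
    (μm : ∀ m, Measure (S.carrier m)) [∀ m, IsFiniteMeasure (μm m)]
    [∀ m, (μm m).IsOpenPosMeasure]
    (V : ℕ → ℝ) (hV : S.UniformLowerBound μ μm V)
    (Φ : ∀ m, Lp ℝ 2 μ →L[ℝ] Lp ℝ 2 (μm m)) (hΦ : S.Connection E μ μm H Φ)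
    -- the coefficients
    (a c : C(X, ℝ)) (lam Lam : ℝ) (hlam : 0 < lam) (ha : ∀ x, lam < a x ∧ a x < Lam)
    (M : ℝ) (hM : 0 < M) (hlam₀ : 0 < lam / 2 - 1 / √M)
    (b b' : ∀ m, (S.energy m).VectorField)
    (hb : BddAbove (Set.range fun m => ‖b m‖ ^ 2))
    (hb' : BddAbove (Set.range fun m => ‖b' m‖ ^ 2))
    (n₀ n₀' : ℕ) (hn₀ : S.Admissible M (⨆ m, ‖b m‖ ^ 2) n₀)
    (hn₀' : S.Admissible M (⨆ m, ‖b' m‖ ^ 2) n₀')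
    (hc : 0 < essInf (fun x => - c x) μ
      - (S.gammaConst V b n₀ + S.gammaConst V b' n₀') / (lam - 2 / √M)) :
    -- elliptic equations
    (∀ (f : Lp ℝ 2 μ) (u : ∀ m, (S.energy m).dom),
      (∀ᶠ m in atTop, (S.energy m).IsWeakSolution (μm m) (a.restrict (S.carrier m)) (b m) (b' m)
        (c.restrict (S.carrier m)) (Φ m f) (u m)) →
      ∀ k : ℕ → ℕ, StrictMono k → ∃ j : ℕ → ℕ, StrictMono j ∧ ∃ v : C(X, ℝ),
        TendstoUniformly (fun i x => (S.ext E (k (j i)) (H (k (j i)) (u (k (j i))))).1 x) v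
          atTop) ∧
    -- parabolic equations
    (∀ (u₀ : Lp ℝ 2 μ) (u : ∀ m, ℝ → Lp ℝ 2 (μm m)),
      (∀ᶠ m in atTop, (S.energy m).IsCauchySolution (μm m) (a.restrict (S.carrier m)) (b m) (b' m)
        (c.restrict (S.carrier m)) (Φ m u₀) (u m)) →
      ∀ t > 0, ∀ k : ℕ → ℕ, StrictMono k → ∃ j : ℕ → ℕ, StrictMono j ∧ ∃ v : C(X, ℝ),
        TendstoUniformly (fun i x => (S.ext E (k (j i)) (H (k (j i))
          ((S.energy (k (j i))).rep (μm (k (j i))) (u (k (j i)) t)))).1 x) v atTop) := by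
  obtain ⟨δ, hδ, K, hQ⟩ := ApproxSpaces.exists_uniform_bilin hdiam hcomp hH hdecay hV hΦ
    (fun x => (ha x).1.le) hM hlam₀ hb hb' hn₀ hn₀' hc
  obtain ⟨P, hP⟩ := hΦ.bounded
  -- Uniform boundedness of Φ_m makes the data, and with the uniform δ and K the energies of the
  -- solutions, bounded independently of m.
  have hΦle : ∀ (g : Lp ℝ 2 μ) m, ‖Φ m g‖ ^ 2 ≤ (P * ‖g‖) ^ 2 := fun g m =>
    pow_le_pow_left₀ (norm_nonneg _) ((Φ m).le_of_opNorm_le (hP ⟨m, rfl⟩) g) 2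
  refine ⟨fun f u hu k hk => ?_, fun u₀ u hu t ht k hk => ?_⟩
  · refine ApproxSpaces.exists_tendstoUniformly_ext hcomp hH hΦ u
      (K := (P * ‖f‖) ^ 2 / δ ^ 2) ?_ hk
    filter_upwards [hQ, hu] with m hm hum
    refine ((S.energy m).energyOne_le_of_isWeakSolution (μm m) hδ hm.1 (hum (u m))).trans ?_
    exact div_le_div_of_nonneg_right (hΦle f m) (by positivity)
  · refine ApproxSpaces.exists_tendstoUniformly_ext hcomp hH hΦ
      (fun m => (S.energy m).rep (μm m) (u m t))
      (K := (K / δ) ^ 2 * (P * ‖u₀‖) ^ 2 / t ^ 2 / δ ^ 2) ?_ hk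
    filter_upwards [hQ, hu] with m hm hum
    refine ((S.energy m).energyOne_rep_le_of_isCauchySolution (μm m) hδ hm.1 hm.2 hum
      ht).trans ?_
    have := hΦle u₀ m
    gcongr
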